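/- Let $m\ge 2$, let $\mathbb{B}\subset\mathbb{R}^{2m}$ be the open unit ball, with coordinates $(x_1,y_1,\dots,x_m,y_m)$, symplectic form $\omega=\sum_{i=1}^m dx_i\wedge dy_i$ and primitive $\lambda=\frac12\sum_{i=1}^m (x_i\,dy_i-y_i\,dx_i)$. For a compactly supported symplectomorphism $\varphi$ of $(\mathbb{B},\omega)$, the action $\sigma_{\varphi}:\mathbb{B}\to\mathbb{R}$ is the unique smooth function with $d\sigma_\varphi=\varphi^*\lambda-\lambda$ that vanishes near $\partial\mathbb{B}$, and $\mathrm{CAL}(\varphi)=\int_{\mathbb{B}}\sigma_\varphi\,\omega^m$. **Lemma.** Let $\{\varphi^t\}_{t\in[0,1]}$ be a smooth isotopy of symplectomorphisms of $(\mathbb{B},\omega)$, all supported in a common compact subset of $\mathbb{B}$, with $\varphi^0=\mathrm{id}$ and $\varphi^1=\varphi$. Let $L>0$ be such that $\tau_t:=\sigma_{\varphi^t}+L>0$ on $\mathbb{B}$ for all $t\in[0,1]$, and put $\tau:=\tau_1$. Then there is a smooth contact form $\beta$ on $\mathbb{R}/L\mathbb{Z}\times\mathbb{B}$, that is, a smooth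 1-form for which $\beta\wedge(d\beta)^m$ vanishes nowhere, with Reeb vector field $R_\beta$ (given by $\beta(R_\beta)=1$, $d\beta(R_\beta,\cdot)=0$), such that the following hold, where $s$ is the coordinate on $\mathbb{R}/L\mathbb{Z}$ and a neighbourhood of the boundary is a set containing $\{(s,z): r<|z|<1\}$ for some $r<1$. 1. $\int_{\mathbb{R}/L\mathbb{Z}\times\mathbb{B}}\beta\wedge(d\beta)^m=L\pi^m+\mathrm{CAL}(\varphi)$, where the integral converges absolutely and the orientation is given by $ds\wedge\omega^m$. 2. $\beta=ds+\lambda$ on a neighbourhood of the boundary of $\mathbb{R}/L\mathbb{Z}\times\mathbb{B}$. In particular $R_\beta=\partial_s$ there, and the flow of $R_\beta$ is globally defined: through every point passes a unique orbit $\gamma:\mathbb{R}\to\mathbb{R}/L\mathbb{Z}\times\mathbb{B}$ of $R_\beta$. 3. The hypersurface $\{0\}\times\mathbb{B}$ is transverse to $R_\beta$, and every orbit of $R_\beta$ meets it both in the future and in the past. 4. For every $z\in\mathbb{B}$, the orbit $\gamma$ with $\gamma(0)=(0,z)$ returns to $\{0\}\times\mathbb{B}$ for the first positive time at time $\tau(z)$,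 and $\gamma(\tau(z))=(0,\varphi(z))$. 5. There is a smooth path $\{\beta_t\}_{t\in[0,1]}$ of contact forms on $\mathbb{R}/L\mathbb{Z}\times\mathbb{B}$ from $\beta_0=ds+\lambda$ to $\beta_1=\beta$, all of which coincide with $ds+\lambda$ on one fixed neighbourhood of the boundary. -/

import Mathlib

open Set Metric MeasureTheory
open scoped ContDiff Topology

noncomputable section

namespace ContactTorus

/-- The Euclidean space `ℝ^{2m}`; the coordinates of `z` are `x_i = z (i, 0)` and
`y_i = z (i, 1)`. -/
abbrev E (m : ℕ) : Type := EuclideanSpace ℝ (Fin m × Fin 2)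

/-- The open unit ball of `ℝ^{2m}`. -/
def B (m : ℕ) : Set (E m) := ball 0 1

/-- The primitive `λ = (1/2) ∑ (x_i dy_i - y_i dx_i)` of the standard symplectic form. -/
def liouville {m : ℕ} (z : E m) : E m →L[ℝ] ℝ :=
  (1 / 2 : ℝ) • ∑ i : Fin m,
    (z (i, 0) • (EuclideanSpace.proj (i, 1) : E m →L[ℝ] ℝ)
      - z (i, 1) • (EuclideanSpace.proj (i, 0) : E m →L[ℝ] ℝ))

/-- The standard symplectic form `ω = ∑ dx_i ∧ dy_i`. -/
def stdSymplectic {m : ℕ} (u v : E m) : ℝ :=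
  ∑ i : Fin m, (u (i, 0) * v (i, 1) - u (i, 1) * v (i, 0))

/-! ### Exterior algebra -/

/-- The exterior derivative of a 1-form `α` on a normed space, at `p`, on the vectors `u, v`. -/
def dForm {V : Type*} [NormedAddCommGroup V] [NormedSpace ℝ V]
    (α : V → V →L[ℝ] ℝ) (p u v : V) : ℝ :=
  extDeriv (fun q => ContinuousAlternatingMap.ofSubsingleton ℝ V ℝ (0 : Fin 1) (α q)) p ![u, v]

/-- The `2m`-form `b ∧ ⋯ ∧ b` (`m` factors) of a 2-form `b`, evaluated on vectors `v`. The indices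
are ordered as `(0,0), (0,1), (1,0), (1,1), …`. The normalisation of the wedge product is the one
for which `dx ∧ dy` takes the value `1` on `(∂_x, ∂_y)`. -/
def wedgePow {V : Type*} {m : ℕ} (b : V → V → ℝ) (v : Fin m × Fin 2 → V) : ℝ :=
  (1 / 2 ^ m : ℝ) * ∑ σ : Equiv.Perm (Fin m × Fin 2),
    ((Equiv.Perm.sign σ : ℤ) : ℝ) * ∏ i : Fin m, b (v (σ (i, 0))) (v (σ (i, 1)))

/-- The `(2m+1)`-form `a ∧ b ∧ ⋯ ∧ b` (`m` factors `b`) of a 1-form `a` and a 2-form `b`, evaluated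
on vectors `v`. The indices are ordered as `none, (0,0), (0,1), (1,0), (1,1), …`. -/
def wedgeOnePow {V : Type*} {m : ℕ} (a : V → ℝ) (b : V → V → ℝ)
    (v : Option (Fin m × Fin 2) → V) : ℝ :=
  (1 / 2 ^ m : ℝ) * ∑ σ : Equiv.Perm (Option (Fin m × Fin 2)),
    ((Equiv.Perm.sign σ : ℤ) : ℝ) * (a (v (σ none)) *
      ∏ i : Fin m, b (v (σ (some (i, 0)))) (v (σ (some (i, 1)))))

/-- The frame `∂_{x_1}, ∂_{y_1}, …, ∂_{x_m}, ∂_{y_m}` of `ℝ^{2m}`. -/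
def frameE (m : ℕ) (j : Fin m × Fin 2) : E m := EuclideanSpace.single j 1

/-- The frame `∂_s, ∂_{x_1}, ∂_{y_1}, …, ∂_{x_m}, ∂_{y_m}` of `ℝ × ℝ^{2m}`. -/
def frame (m : ℕ) : Option (Fin m × Fin 2) → ℝ × E m
  | none => (1, 0)
  | some j => (0, frameE m j)

/-! ### Compactly supported symplectomorphisms, action and Calabi invariant -/

/-- `φ` restricts to a compactly supported symplectomorphism of the open unit ball. (The values of
`φ` outside the ball are irrelevant.) -/
structure IsCompSymplecto {m : ℕ} (φ : E m → E m) : Prop where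
  bijOn : BijOn φ (B m) (B m)
  contDiffOn : ContDiffOn ℝ ∞ φ (B m)
  contDiffOn_inv : ContDiffOn ℝ ∞ (Function.invFunOn φ (B m)) (B m)
  symplectic : ∀ z ∈ B m, ∀ u v : E m,
    stdSymplectic (fderiv ℝ φ z u) (fderiv ℝ φ z v) = stdSymplectic u v
  compactSupport : ∃ K : Set (E m), IsCompact K ∧ K ⊆ B m ∧ ∀ z ∈ B m, z ∉ K → φ z = z

/-- `φ t`, `t ∈ [0, 1]`, is a smooth isotopy of compactly supported symplectomorphisms of the ball
which starts at the identity; the supports lie in a common compact subset of the ball. -/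
structure IsCompSymplIsotopy {m : ℕ} (φ : ℝ → E m → E m) : Prop where
  contDiffOn : ContDiffOn ℝ ∞ (fun q : ℝ × E m => φ q.1 q.2) (Icc 0 1 ×ˢ B m)
  symplecto : ∀ t ∈ Icc (0 : ℝ) 1, IsCompSymplecto (φ t)
  zero : ∀ z ∈ B m, φ 0 z = z
  compactSupport : ∃ K : Set (E m), IsCompact K ∧ K ⊆ B m ∧
    ∀ t ∈ Icc (0 : ℝ) 1, ∀ z ∈ B m, z ∉ K → φ t z = z

/-- `dσ = φ^* λ - λ` on the ball, and `σ` vanishes near the boundary of the ball. -/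
structure IsAction {m : ℕ} (φ : E m → E m) (σ : E m → ℝ) : Prop where
  contDiffOn : ContDiffOn ℝ ∞ σ (B m)
  fderiv_eq : ∀ z ∈ B m, fderiv ℝ σ z = (liouville (φ z)).comp (fderiv ℝ φ z) - liouville z
  zero_near : ∃ r < (1 : ℝ), ∀ z ∈ B m, r < ‖z‖ → σ z = 0

open Classical in
/-- The action `σ_{φ,λ}` of `φ`: the function determined on the ball by `IsAction`. -/
def action {m : ℕ} (φ : E m → E m) : E m → ℝ :=
  if h : ∃ σ, IsAction φ σ then h.choose else 0

/-- The Calabi invariant `∫_B σ_{φ,λ} ω^m`. -/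
def calabi {m : ℕ} (φ : E m → E m) : ℝ :=
  ∫ z in B m, action φ z * wedgePow stdSymplectic (frameE m)

/-! ### 1-forms on `ℝ/Lℤ × B` -/

/-- A 1-form on `ℝ/Lℤ × ℝ^{2m}`, in the global trivialisation of the cotangent bundle given by
`ds, dx_i, dy_i`. Only its values on `ℝ/Lℤ × B` matter below. -/
abbrev OneForm (L : ℝ) (m : ℕ) : Type := AddCircle L × E m → (ℝ × E m) →L[ℝ] ℝ

/-- The covering map `ℝ × ℝ^{2m} → ℝ/Lℤ × ℝ^{2m}`. -/
def proj (L : ℝ) {m : ℕ} (p : ℝ × E m) : AddCircle L × E m := ((p.1 : AddCircle L), p.2)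

/-- The pull-back of a 1-form under the covering map. -/
def OneForm.lift {L : ℝ} {m : ℕ} (β : OneForm L m) : ℝ × E m → (ℝ × E m) →L[ℝ] ℝ :=
  fun p => β (proj L p)

/-- The 1-form `ds + λ`. -/
def stdForm (L : ℝ) (m : ℕ) : OneForm L m := fun x =>
  ContinuousLinearMap.fst ℝ ℝ (E m) + (liouville x.2).comp (ContinuousLinearMap.snd ℝ ℝ (E m))

/-- The coefficient of `β ∧ (dβ)^m` with respect to `ds ∧ dx_1 ∧ dy_1 ∧ ⋯ ∧ dx_m ∧ dy_m`, at the
image of `p` in `ℝ/Lℤ × B`. -/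
def volCoeff {L : ℝ} {m : ℕ} (β : OneForm L m) (p : ℝ × E m) : ℝ :=
  wedgeOnePow (β.lift p) (dForm β.lift p) (frame m)

/-- `β` is a (smooth) contact form on `ℝ/Lℤ × B`. -/
structure IsContactForm {L : ℝ} {m : ℕ} (β : OneForm L m) : Prop where
  contDiffOn : ContDiffOn ℝ ∞ β.lift (univ ×ˢ B m)
  nondegenerate : ∀ p ∈ (univ : Set ℝ) ×ˢ B m, volCoeff β p ≠ 0

/-- The contact volume: the integral of `β ∧ (dβ)^m` over `ℝ/Lℤ × B`, computed on the fundamental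
domain `(0, L] × B`. -/
def contactVolume {L : ℝ} {m : ℕ} (β : OneForm L m) : ℝ :=
  ∫ p in Ioc 0 L ×ˢ B m, volCoeff β p

/-- The tangent vector `w` is the value of the Reeb vector field of `β` at the image of `p`. -/
def IsReebVector {L : ℝ} {m : ℕ} (β : OneForm L m) (p w : ℝ × E m) : Prop :=
  β.lift p w = 1 ∧ ∀ v, dForm β.lift p w v = 0

/-- `γ` is an orbit of the Reeb flow on `ℝ/Lℤ × B`, parametrised by all of `ℝ`. Its velocity is read
off from a lift to `ℝ × B`. -/
def IsReebOrbit {L : ℝ} {m : ℕ} (β : OneForm L m) (γ : ℝ → AddCircle L × E m) : Prop :=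
  ∃ c : ℝ → ℝ × E m, ∀ t, γ t = proj L (c t) ∧ (c t).2 ∈ B m ∧
    ∃ w, IsReebVector β (c t) w ∧ HasDerivAt c w t

/-! ### The definitions agree with the usual formulas -/

theorem dForm_eq {V : Type*} [NormedAddCommGroup V] [NormedSpace ℝ V]
    {α : V → V →L[ℝ] ℝ} {p : V} (h : DifferentiableAt ℝ α p) (u v : V) :
    dForm α p u v = fderiv ℝ α p u v - fderiv ℝ α p v u := by
  have h2 := (ContinuousAlternatingMap.ofSubsingletonLIE (𝕜 := ℝ) (E := V) (F := ℝ)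
    (0 : Fin 1)).toContinuousLinearEquiv.hasFDerivAt.comp p h.hasFDerivAt
  change HasFDerivAt
    (fun q => ContinuousAlternatingMap.ofSubsingleton ℝ V ℝ (0 : Fin 1) (α q)) _ p at h2
  have h3 : ∀ w : V, fderiv ℝ (fun q => α q w) p = (fderiv ℝ α p).flip w := fun w => by
    rw [fderiv_clm_apply h (differentiableAt_const w)]
    simp
  rw [dForm, extDeriv_apply h2.differentiableAt]
  simp [Fin.sum_univ_two, Fin.removeNth, h3, sub_eq_add_neg]

theorem liouville_apply {m : ℕ} (z v : E m) : liouville z v =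
    (1 / 2) * ∑ i : Fin m, (z (i, 0) * v (i, 1) - z (i, 1) * v (i, 0)) := by
  simp [liouville]

theorem liouville_sub_swap {m : ℕ} (u v : E m) :
    liouville u v - liouville v u = stdSymplectic u v := by
  rw [liouville_apply, liouville_apply, ← mul_sub, ← Finset.sum_sub_distrib, Finset.mul_sum]
  exact Finset.sum_congr rfl fun i _ => by ring

theorem exists_liouville_eq (m : ℕ) :
    ∃ l : E m →L[ℝ] E m →L[ℝ] ℝ, ∀ z, liouville z = l z := by
  have h : IsLinearMap ℝ (liouville : E m → E m →L[ℝ] ℝ) := by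
    constructor
    · intro x y
      ext v
      simp only [liouville_apply, add_apply, PiLp.add_apply, ← mul_add,
        ← Finset.sum_add_distrib]
      congr 1
      exact Finset.sum_congr rfl fun i _ => by ring
    · intro c x
      ext v
      simp only [liouville_apply, smul_apply, PiLp.smul_apply, smul_eq_mul,
        Finset.mul_sum]
      exact Finset.sum_congr rfl fun i _ => by ring
  exact ⟨LinearMap.toContinuousLinearMap (IsLinearMap.mk' _ h), fun z => rfl⟩

theorem dForm_liouville {m : ℕ} (z u v : E m) :
    dForm (liouville (m := m)) z u v = stdSymplectic u v := by
  obtain ⟨l, hl⟩ := exists_liouville_eq m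
  have hl' : (liouville : E m → E m →L[ℝ] ℝ) = l := funext hl
  rw [dForm_eq (by rw [hl']; exact l.differentiableAt), hl', l.fderiv, ← hl, ← hl,
    liouville_sub_swap]

theorem isPreconnected_annulus {m : ℕ} (hm : 1 ≤ m) {r : ℝ} (hr : 0 < r) :
    IsPreconnected {z : E m | r < ‖z‖ ∧ ‖z‖ < 1} := by
  have h1 : IsPreconnected (sphere (0 : E m) 1) := by
    apply isPreconnected_sphere
    rw [← Module.finrank_eq_rank]
    have : 1 < Module.finrank ℝ (E m) := by simp; omega
    exact_mod_cast this
  have h2 := (h1.prod (isPreconnected_Ioo (a := r) (b := 1))).image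
    (fun q : E m × ℝ => q.2 • q.1) (by fun_prop)
  convert h2 using 1
  ext z
  constructor
  · rintro ⟨hz1, hz2⟩
    have hz : ‖z‖ ≠ 0 := (hr.trans hz1).ne'
    refine ⟨(‖z‖⁻¹ • z, ‖z‖), ⟨?_, hz1, hz2⟩, ?_⟩
    · simp [norm_smul, hz]
    · simp [smul_smul, hz]
  · rintro ⟨⟨x, t⟩, ⟨hx, ht1, ht2⟩, rfl⟩
    simp only [mem_sphere_iff_norm, sub_zero] at hx
    have ht : 0 < t := hr.trans ht1
    simpa [norm_smul, hx, abs_of_pos ht] using ⟨ht1, ht2⟩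

theorem exists_isAction {m : ℕ} (hm : 1 ≤ m) {φ : E m → E m} (hφ : IsCompSymplecto φ) :
    ∃ σ, IsAction φ σ := by
  have hBo : IsOpen (B m) := isOpen_ball
  obtain ⟨l, hl⟩ := exists_liouville_eq m
  have hl' : (liouville : E m → E m →L[ℝ] ℝ) = l := funext hl
  let α : E m → E m →L[ℝ] ℝ := fun z => (l (φ z)).comp (fderiv ℝ φ z) - l z
  have hD : ContDiffOn ℝ ∞ (fderiv ℝ φ) (B m) :=
    hφ.contDiffOn.fderiv_of_isOpen hBo (by simp)
  have hα : ContDiffOn ℝ ∞ α (B m) :=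
    ((l.contDiff.comp_contDiffOn hφ.contDiffOn).clm_comp hD).sub l.contDiff.contDiffOn
  have hsym : ∀ a ∈ B m, ∀ x y, fderiv ℝ α a x y = fderiv ℝ α a y x := by
    intro a ha x y
    have hφa : ContDiffAt ℝ ∞ φ a := hφ.contDiffOn.contDiffAt (hBo.mem_nhds ha)
    have e1 : HasFDerivAt φ (fderiv ℝ φ a) a :=
      (hφa.differentiableAt (by simp)).hasFDerivAt
    have e2 : HasFDerivAt (fderiv ℝ φ) (fderiv ℝ (fderiv ℝ φ) a) a :=
      ((hD.contDiffAt (hBo.mem_nhds ha)).differentiableAt (by simp)).hasFDerivAt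
    have e3 := ((l.hasFDerivAt.comp a e1).clm_comp e2).sub (l.hasFDerivAt (x := a))
    have e4 : fderiv ℝ α a = _ := HasFDerivAt.fderiv e3
    have s1 : fderiv ℝ (fderiv ℝ φ) a x y = fderiv ℝ (fderiv ℝ φ) a y x :=
      (hφa.isSymmSndFDerivAt (by
        rw [minSmoothness_of_isRCLikeNormedField]
        exact WithTop.coe_le_coe.2 (le_top : (2 : ℕ∞) ≤ ⊤))) x y
    have s2 := hφ.symplectic a ha x y
    rw [← liouville_sub_swap, ← liouville_sub_swap, hl'] at s2
    rw [e4]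
    simp [s1]
    linarith
  obtain ⟨f, hf⟩ := (convex_ball (0 : E m) 1).exists_forall_hasFDerivAt_of_fderiv_symmetric hBo
    (hα.differentiableOn (by simp)) hsym
  obtain ⟨K, hK, hKB, hKφ⟩ := hφ.compactSupport
  obtain ⟨r, hr0, hr1, hr⟩ : ∃ r : ℝ, 0 < r ∧ r < 1 ∧ ∀ z ∈ K, ‖z‖ ≤ r := by
    rcases K.eq_empty_or_nonempty with rfl | hne
    · exact ⟨1 / 2, by norm_num, by norm_num, by simp⟩
    · obtain ⟨z, hz, hmax⟩ := hK.exists_isMaxOn hne continuous_norm.continuousOn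
      have hz1 : ‖z‖ < 1 := by simpa [B] using hKB hz
      refine ⟨(‖z‖ + 1) / 2, by positivity, by linarith, fun w hw => ?_⟩
      have : ‖w‖ ≤ ‖z‖ := hmax hw
      linarith
  let A : Set (E m) := {z | r < ‖z‖ ∧ ‖z‖ < 1}
  have hAB : A ⊆ B m := fun z hz => by simpa [B] using hz.2
  have hAo : IsOpen A := (isOpen_lt continuous_const continuous_norm).inter
    (isOpen_lt continuous_norm continuous_const)
  have hα0 : EqOn (fderiv ℝ f) 0 A := by
    intro z hz
    have hid : φ =ᶠ[𝓝 z] id := by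
      filter_upwards [hAo.mem_nhds hz] with w hw
      exact hKφ w (hAB hw) fun h => absurd (hr w h) (not_le.2 hw.1)
    rw [(hf z (hAB hz)).fderiv]
    simp only [α, hid.fderiv_eq, hid.eq_of_nhds, fderiv_id]
    ext v
    simp
  obtain ⟨c, hc⟩ := hAo.exists_is_const_of_fderiv_eq_zero (isPreconnected_annulus hm hr0)
    (fun z hz => (hf z (hAB hz)).differentiableAt.differentiableWithinAt) hα0
  have hfc : ∀ z ∈ B m, HasFDerivAt (fun w => f w - c) (α z) z :=
    fun z hz => (hf z hz).sub_const c
  refine ⟨fun z => f z - c, ?_, ?_, ⟨r, hr1, fun z hz hrz => ?_⟩⟩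
  · have hd : ContDiffOn ℝ (∞ + 1) (fun w => f w - c) (B m) := by
      rw [contDiffOn_succ_iff_fderiv_of_isOpen hBo]
      exact ⟨fun z hz => (hfc z hz).differentiableAt.differentiableWithinAt, by simp,
        hα.congr fun z hz => (hfc z hz).fderiv⟩
    exact hd.of_le (by simp)
  · intro z hz
    rw [(hfc z hz).fderiv, hl']
  · have hz1 : ‖z‖ < 1 := by simpa [B] using hz
    simp [hc z ⟨hrz, hz1⟩]

theorem action_spec {m : ℕ} (hm : 1 ≤ m) {φ : E m → E m} (hφ : IsCompSymplecto φ) :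
    IsAction φ (action φ) := by
  have h := exists_isAction hm hφ
  rw [action, dif_pos h]
  exact h.choose_spec

theorem IsAction.eqOn {m : ℕ} (hm : 1 ≤ m) {φ : E m → E m} {σ σ' : E m → ℝ}
    (h : IsAction φ σ) (h' : IsAction φ σ') : EqOn σ σ' (B m) := by
  have hBo : IsOpen (B m) := isOpen_ball
  obtain ⟨r, hr1, hr⟩ := h.zero_near
  obtain ⟨r', hr1', hr'⟩ := h'.zero_near
  obtain ⟨t, ht, ht1⟩ := exists_between (max_lt (max_lt hr1 hr1') zero_lt_one)
  have ht0 : 0 < t := lt_of_le_of_lt (le_max_right _ _) ht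
  have htr : max r r' < t := lt_of_le_of_lt (le_max_left _ _) ht
  let z₀ : E m := EuclideanSpace.single (⟨0, hm⟩, 0) t
  have hz₀ : ‖z₀‖ = t := by simp [z₀, abs_of_pos ht0]
  have hz₀B : z₀ ∈ B m := by simpa [B, hz₀] using ht1
  intro z hz
  refine hBo.eqOn_of_fderiv_eq (convex_ball (0 : E m) 1).isPreconnected
    (h.contDiffOn.differentiableOn (by simp)) (h'.contDiffOn.differentiableOn (by simp))
    (fun w hw => ?_) hz₀B ?_ hz
  · rw [h.fderiv_eq w hw, h'.fderiv_eq w hw]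
  · rw [hr z₀ hz₀B (by rw [hz₀]; exact lt_of_le_of_lt (le_max_left _ _) htr),
      hr' z₀ hz₀B (by rw [hz₀]; exact lt_of_le_of_lt (le_max_right _ _) htr)]

end ContactTorus

end

open ContactTorus

/-! Write `Ξ = φ⁻¹` and let `deck (s, z) = (s + L + σ (Ξ z), Ξ z)` act on `ℝ × ℝ^{2m}`. Since `dσ =
φ^*λ - λ`, pulling back by `Ξ` gives `d(σ ∘ Ξ) = λ - Ξ^*λ`, so `deck` preserves `ds + λ`
(`deck_pullback`). The quotient by `deck` is the mapping torus. The flow of `∂_s` on it starts on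
`{0} × B`, next meets `deck ({0} × B)`, which is the graph of `τ = σ + L`, and `(τ z, z) = deck (0,
φ z)`. Return time and return map are therefore the required ones, and the contact volume is `m!`
times the volume of the region between the two hypersurfaces.

It remains to identify this quotient with `ℝ/Lℤ × B`. A step function `a` from 0 to 1 gives over
`[0, L]` the map `(s, z) ↦ (s + a(s) σ_t(w), w)` with `w = φ_{t a(s)}⁻¹ z`. It is the identity near
one end and agrees with `deck` after a shift near the other, so it extends to an equivariant smooth
map `dev t`. This is a diffeomorphism because `a' (L - δ) < 1`, where `δ` is a uniform lower bound
of all return times: then `1 + a' σ_t > 0` (`one_add_deriv_pos`). The form `β_t` is the descent of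
`dev_t^*(ds + λ)`. Being a pull-back by a diffeomorphism it is contact for every `t`, and its Reeb
orbits are the preimages of the lines in direction `∂_s` (`isReebVector_iff`, `exists_eq_orbit`).
For `t = 0`, and near the boundary, `dev t` is the identity.

Two preparations are needed: the isotopy, its inverses and its actions must be smooth jointly in
time and space on the whole of `ℝ × ℝ^{2m}` (`exists_globalIsotopy`), and the top-degree form must
transform by the determinant (`wedgeOnePow_comp`). -/

noncomputable section

namespace ContactTorus

/-! ### Wedge products -/

/-- The multilinear map `v ↦ a (v none) * ∏ i, b (v (i, 0)) (v (i, 1))`. -/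
def tensorOnePow {V : Type*} [AddCommGroup V] [Module ℝ V] (m : ℕ) (a : V →ₗ[ℝ] ℝ)
    (b : V →ₗ[ℝ] V →ₗ[ℝ] ℝ) :
    MultilinearMap ℝ (fun _ : Option (Fin m × Fin 2) => V) ℝ :=
  -- Each slot occurs in exactly one factor, so with the other slots frozen the product is a linear
  -- functional of that slot. The functional `l` gives additivity and homogeneity at once.
  have key : ∀ (v : Option (Fin m × Fin 2) → V) (j : Option (Fin m × Fin 2)),
      ∃ l : V →ₗ[ℝ] ℝ, ∀ x, a (Function.update v j x none) *
        ∏ i : Fin m, b (Function.update v j x (some (i, 0)))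
          (Function.update v j x (some (i, 1))) = l x := by
    classical
    intro v j
    rcases j with _ | ⟨j, k⟩
    · refine ⟨(∏ i : Fin m, b (v (some (i, 0))) (v (some (i, 1)))) • a, fun x => ?_⟩
      simp [mul_comm]
    · have hne : ∀ (i : Fin m) (k' : Fin 2), i ∈ Finset.univ.erase j →
          (some (i, k') : Option (Fin m × Fin 2)) ≠ some (j, k) := by
        intro i k' hi h
        simp only [Option.some.injEq, Prod.mk.injEq] at h
        exact (Finset.ne_of_mem_erase hi) h.1
      have hprod : ∀ x, ∏ i ∈ Finset.univ.erase j,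
          b (Function.update v (some (j, k)) x (some (i, 0)))
            (Function.update v (some (j, k)) x (some (i, 1))) =
          ∏ i ∈ Finset.univ.erase j, b (v (some (i, 0))) (v (some (i, 1))) := by
        intro x
        refine Finset.prod_congr rfl fun i hi => ?_
        rw [Function.update_of_ne (hne i 0 hi), Function.update_of_ne (hne i 1 hi)]
      set c := a (v none) * ∏ i ∈ Finset.univ.erase j, b (v (some (i, 0))) (v (some (i, 1)))
        with hc
      fin_cases k
      · refine ⟨c • b.flip (v (some (j, 1))), fun x => ?_⟩
        rw [← Finset.mul_prod_erase Finset.univ _ (Finset.mem_univ j), hprod]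
        simp [hc]
        ring
      · refine ⟨c • b (v (some (j, 0))), fun x => ?_⟩
        rw [← Finset.mul_prod_erase Finset.univ _ (Finset.mem_univ j), hprod]
        simp [hc]
        ring
  { toFun := fun v => a (v none) * ∏ i : Fin m, b (v (some (i, 0))) (v (some (i, 1)))
    map_update_add' := fun {inst} v j x y => by
      rw [Subsingleton.elim inst (Classical.decEq _)] at *
      obtain ⟨l, hl⟩ := key v j
      have h1 := hl x
      have h2 := hl y
      have h3 := hl (x + y)
      rw [map_add, ← h1, ← h2] at h3
      convert h3
    map_update_smul' := fun {inst} v j c x => by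
      rw [Subsingleton.elim inst (Classical.decEq _)] at *
      obtain ⟨l, hl⟩ := key v j
      have h1 := hl x
      have h3 := hl (c • x)
      rw [map_smul, ← h1] at h3
      convert h3 }

/-- This makes the wedge product an alternating map of top degree, hence a multiple of the
determinant of a basis. -/
theorem wedgeOnePow_eq_alternatization {V : Type*} [AddCommGroup V] [Module ℝ V] {m : ℕ}
    (a : V →ₗ[ℝ] ℝ) (b : V →ₗ[ℝ] V →ₗ[ℝ] ℝ) (v : Option (Fin m × Fin 2) → V) :
    wedgeOnePow a (fun x y => b x y) v =
      (1 / 2 ^ m : ℝ) * MultilinearMap.alternatization (tensorOnePow m a b) v := by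
  rw [MultilinearMap.alternatization_apply, wedgeOnePow]
  congr 1
  refine Finset.sum_congr rfl fun σ _ => ?_
  rw [Units.smul_def, zsmul_eq_mul]
  rfl

/-- Pulling back a top-degree product of forms multiplies it by the determinant. -/
theorem wedgeOnePow_comp {V : Type*} [AddCommGroup V] [Module ℝ V] {m : ℕ}
    (a : V →ₗ[ℝ] ℝ) (b : V →ₗ[ℝ] V →ₗ[ℝ] ℝ) (e : Module.Basis (Option (Fin m × Fin 2)) ℝ V)
    (T : V →ₗ[ℝ] V) :
    wedgeOnePow (fun x => a (T x)) (fun x y => b (T x) (T y)) e =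
      LinearMap.det T * wedgeOnePow a (fun x y => b x y) e := by
  have h : wedgeOnePow (fun x => a (T x)) (fun x y => b (T x) (T y)) e =
      wedgeOnePow a (fun x y => b x y) (T ∘ e) := rfl
  rw [h, wedgeOnePow_eq_alternatization, wedgeOnePow_eq_alternatization,
    (MultilinearMap.alternatization (tensorOnePow m a b)).eq_smul_basis_det e]
  simp only [AlternatingMap.smul_apply, smul_eq_mul, e.det_comp, e.det_self]
  ring

/-- Split the permutations by the image of `none`. If `none` is moved, the vector `v none` lands in
a factor `b` and kills the term. If it is fixed, `a` contributes 1 and a permutation of the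
remaining indices with the same sign is left. -/
theorem wedgeOnePow_eq_wedgePow {V : Type*} {m : ℕ} (a : V → ℝ) (b : V → V → ℝ)
    (v : Option (Fin m × Fin 2) → V) (ha : a (v none) = 1) (hl : ∀ x, b (v none) x = 0)
    (hr : ∀ x, b x (v none) = 0) :
    wedgeOnePow a b v = wedgePow b (fun j => v (some j)) := by
  rw [wedgeOnePow, wedgePow, ← Equiv.Perm.decomposeOption.symm.sum_comp, Fintype.sum_prod_type,
    Fintype.sum_option, Finset.sum_eq_zero (s := Finset.univ (α := Fin m × Fin 2)), add_zero]
  · congr 1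
    refine Finset.sum_congr rfl fun σ _ => ?_
    simp [ha]
  · rintro j -
    refine Finset.sum_eq_zero fun σ _ => ?_
    obtain ⟨⟨i, k⟩, hik⟩ := σ.surjective j
    have : ∏ i : Fin m,
        b (v (Equiv.Perm.decomposeOption.symm (some j, σ) (some (i, 0))))
          (v (Equiv.Perm.decomposeOption.symm (some j, σ) (some (i, 1)))) = 0 := by
      refine Finset.prod_eq_zero (Finset.mem_univ i) ?_
      fin_cases k
      · simp only [Fin.zero_eta] at hik
        simp [hik, hl]
      · simp only [Fin.mk_one] at hik
        simp [hik, hr]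
    rw [this, mul_zero, mul_zero]

theorem stdSymplectic_frameE {m : ℕ} (p q : Fin m × Fin 2) :
    stdSymplectic (frameE m p) (frameE m q) =
      if p.1 = q.1 then ((if p.2 = 0 ∧ q.2 = 1 then 1 else 0) -
        (if p.2 = 1 ∧ q.2 = 0 then 1 else 0)) else 0 := by
  obtain ⟨i, k⟩ := p
  obtain ⟨j, l⟩ := q
  simp only [stdSymplectic, frameE, PiLp.single_apply, Prod.mk.injEq]
  by_cases hij : i = j
  · subst hij
    rw [Finset.sum_eq_single i]
    · fin_cases k <;> fin_cases l <;> simp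
    · intro b _ hb
      simp [hb]
    · simp
  · rw [if_neg hij]
    refine Finset.sum_eq_zero fun b _ => ?_
    by_cases hb : b = i
    · have : b ≠ j := fun h => hij (hb.symm.trans h)
      simp [this]
    · simp [hb]

/-- The permutation of `Fin m × Fin 2` that permutes the pairs by `p.1` and flips them by `p.2`. -/
def pairPerm {m : ℕ} (p : Equiv.Perm (Fin m) × (Fin m → Equiv.Perm (Fin 2))) :
    Equiv.Perm (Fin m × Fin 2) :=
  Equiv.prodCongrLeft (fun _ : Fin 2 => p.1) * Equiv.prodCongrRight p.2

theorem pairPerm_apply {m : ℕ} (p : Equiv.Perm (Fin m) × (Fin m → Equiv.Perm (Fin 2)))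
    (i : Fin m) (k : Fin 2) : pairPerm p (i, k) = (p.1 i, p.2 i k) := rfl

/-- The permutation of the pairs acts once on each of the two columns, so its sign enters squared.
-/
theorem sign_pairPerm {m : ℕ} (p : Equiv.Perm (Fin m) × (Fin m → Equiv.Perm (Fin 2))) :
    Equiv.Perm.sign (pairPerm p) = ∏ i, Equiv.Perm.sign (p.2 i) := by
  rw [pairPerm, map_mul, Equiv.Perm.sign_prodCongrLeft, Equiv.Perm.sign_prodCongrRight]
  simp

/-- Injectivity of `σ` makes the second component a bijection on each pair, and then makes the
induced map on pairs injective. Only these permutations contribute to `ω^m`. -/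
theorem mem_range_pairPerm {m : ℕ} (σ : Equiv.Perm (Fin m × Fin 2))
    (h : ∀ i, (σ (i, 0)).1 = (σ (i, 1)).1) : ∃ p, pairPerm p = σ := by
  have h1 : ∀ i k, (σ (i, k)).1 = (σ (i, 0)).1 := by
    intro i k
    fin_cases k
    · rfl
    · exact (h i).symm
  have hε : ∀ i, Function.Bijective fun k => (σ (i, k)).2 := by
    intro i
    refine Finite.injective_iff_bijective.1 fun k l hkl => ?_
    have := σ.injective (Prod.ext ((h1 i k).trans (h1 i l).symm) hkl)
    simpa using this
  have hπ : Function.Bijective fun i => (σ (i, 0)).1 := by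
    refine Finite.injective_iff_bijective.1 fun i j hij => ?_
    obtain ⟨k, hk⟩ := (hε i).2 (σ (j, 0)).2
    have := σ.injective (Prod.ext ((h1 i k).trans hij) hk)
    exact congrArg Prod.fst this
  refine ⟨(Equiv.ofBijective _ hπ, fun i => Equiv.ofBijective _ (hε i)), ?_⟩
  ext x : 1
  exact Prod.ext (h1 x.1 x.2).symm rfl

theorem pairPerm_injective (m : ℕ) : Function.Injective (pairPerm (m := m)) := by
  intro p q h
  have h' : ∀ i k, (p.1 i, p.2 i k) = (q.1 i, q.2 i k) := fun i k => by
    rw [← pairPerm_apply, ← pairPerm_apply, h]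
  refine Prod.ext (Equiv.ext fun i => congrArg Prod.fst (h' i 0)) ?_
  ext i k : 2
  exact congrArg Prod.snd (h' i k)

theorem sign_eq_of_fin_two (ε : Equiv.Perm (Fin 2)) :
    (((if ε 0 = 0 ∧ ε 1 = 1 then 1 else 0) - (if ε 0 = 1 ∧ ε 1 = 0 then 1 else 0) : ℤ)) =
      (Equiv.Perm.sign ε : ℤ) := by
  revert ε
  decide

/-- The coefficient of `ω^m` is `m!`. -/
theorem wedgePow_stdSymplectic_frameE (m : ℕ) :
    wedgePow stdSymplectic (frameE m) = (m.factorial : ℝ) := by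
  -- The `m! * 2^m` permutations respecting the pairs contribute 1 each, because the signs of the
  -- flips occur squared; all others contribute 0. The factor `2^m` cancels the normalisation.
  rw [wedgePow, ← Finset.sum_of_injOn (s := Finset.univ) (f := fun _ => (1 : ℝ)) pairPerm
    (pairPerm_injective m).injOn (fun _ _ => Finset.mem_coe.2 (Finset.mem_univ _))]
  · simp [Fintype.card_perm]
    field_simp
  · intro σ _ hσ
    obtain ⟨i, hi⟩ : ∃ i, (σ (i, 0)).1 ≠ (σ (i, 1)).1 := by
      by_contra! h
      obtain ⟨p, hp⟩ := mem_range_pairPerm σ h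
      exact hσ ⟨p, by simp, hp⟩
    rw [Finset.prod_eq_zero (Finset.mem_univ i) (by rw [stdSymplectic_frameE, if_neg hi]),
      mul_zero]
  · intro p _
    have h : ∀ i : Fin m, stdSymplectic (frameE m (pairPerm p (i, 0)))
        (frameE m (pairPerm p (i, 1))) = ((Equiv.Perm.sign (p.2 i) : ℤ) : ℝ) := by
      intro i
      rw [stdSymplectic_frameE, ← sign_eq_of_fin_two]
      simp only [pairPerm_apply, if_true]
      push_cast
      congr
    simp only [h, sign_pairPerm]
    rw [Units.coe_prod, Int.cast_prod, ← Finset.prod_mul_distrib]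
    refine (Finset.prod_eq_one fun i _ => ?_).symm
    rw [← Int.cast_mul, ← Units.val_mul, Int.units_mul_self]
    simp

/-- The standard frame of `ℝ × ℝ^{2m}` as a basis. -/
def frameBasis (m : ℕ) : Module.Basis (Option (Fin m × Fin 2)) ℝ (ℝ × E m) :=
  ((Module.Basis.singleton Unit ℝ).prod (EuclideanSpace.basisFun (Fin m × Fin 2) ℝ).toBasis).reindex
    ((Equiv.sumComm _ _).trans (Equiv.optionEquivSumPUnit _).symm)

theorem frameBasis_eq (m : ℕ) : ⇑(frameBasis m) = frame m := by
  funext j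
  rcases j with _ | j <;> simp [frameBasis, frame, frameE]

/-- `ω` as a bilinear map. -/
def symplecticBilin (m : ℕ) : E m →ₗ[ℝ] E m →ₗ[ℝ] ℝ :=
  LinearMap.mk₂ ℝ stdSymplectic
    (fun u u' v => by
      simp only [stdSymplectic, PiLp.add_apply, ← Finset.sum_add_distrib]
      exact Finset.sum_congr rfl fun i _ => by ring)
    (fun c u v => by
      simp only [stdSymplectic, PiLp.smul_apply, smul_eq_mul, Finset.mul_sum]
      exact Finset.sum_congr rfl fun i _ => by ring)
    (fun u v v' => by
      simp only [stdSymplectic, PiLp.add_apply, ← Finset.sum_add_distrib]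
      exact Finset.sum_congr rfl fun i _ => by ring)
    (fun c u v => by
      simp only [stdSymplectic, PiLp.smul_apply, smul_eq_mul, Finset.mul_sum]
      exact Finset.sum_congr rfl fun i _ => by ring)

/-- Pairing with the frame recovers the coordinates up to sign. This nondegeneracy makes symplectic
derivatives injective and singles out the Reeb direction. -/
theorem eq_zero_of_stdSymplectic {m : ℕ} {u : E m} (h : ∀ v, stdSymplectic u v = 0) : u = 0 := by
  ext ⟨i, k⟩
  have key : ∀ l, stdSymplectic u (frameE m (i, l)) =
      u (i, 0) * (if (1 : Fin 2) = l then 1 else 0) -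
        u (i, 1) * (if (0 : Fin 2) = l then 1 else 0) := by
    intro l
    rw [stdSymplectic, Finset.sum_eq_single i]
    · simp [frameE]
    · intro b _ hb
      simp [frameE, hb]
    · simp
  have h0 := (key 0).symm.trans (h _)
  have h1 := (key 1).symm.trans (h _)
  fin_cases k
  · simpa using h1
  · simpa using h0

/-- The value of the pull-back of `(ds + λ) ∧ ω^m` under a linear map on the standard frame. -/
theorem wedgeOnePow_stdForm {m : ℕ} (a : E m →L[ℝ] ℝ) (T : (ℝ × E m) →L[ℝ] (ℝ × E m)) :
    wedgeOnePow (fun x => (T x).1 + a (T x).2)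
      (fun x y => stdSymplectic (T x).2 (T y).2) (frame m) = T.det * m.factorial := by
  have h := wedgeOnePow_comp (m := m)
    (LinearMap.fst ℝ ℝ (E m) + a.toLinearMap ∘ₗ LinearMap.snd ℝ ℝ (E m))
    ((symplecticBilin m).compl₁₂ (LinearMap.snd ℝ ℝ (E m)) (LinearMap.snd ℝ ℝ (E m)))
    (frameBasis m) T.toLinearMap
  rw [frameBasis_eq] at h
  refine h.trans ?_
  rw [wedgeOnePow_eq_wedgePow _ _ (frame m) (by simp [frame]) (by simp [frame])
    (by simp [frame]), ContinuousLinearMap.det]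
  congr 1
  exact wedgePow_stdSymplectic_frameE m

/-- The exterior derivative commutes with pull-backs. -/
theorem dForm_pullback {V W : Type*} [NormedAddCommGroup V] [NormedSpace ℝ V]
    [NormedAddCommGroup W] [NormedSpace ℝ W] {α : W → W →L[ℝ] ℝ} {f : V → W} {p : V}
    (hα : DifferentiableAt ℝ α (f p)) (hf : ContDiffAt ℝ ∞ f p) (u v : V) :
    dForm (fun q => (α (f q)).comp (fderiv ℝ f q)) p u v =
      dForm α (f p) (fderiv ℝ f p u) (fderiv ℝ f p v) := by
  have hω : DifferentiableAt ℝ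
      (fun q => ContinuousAlternatingMap.ofSubsingleton ℝ W ℝ (0 : Fin 1) (α q)) (f p) :=
    ((ContinuousAlternatingMap.ofSubsingletonLIE (𝕜 := ℝ) (E := W) (F := ℝ)
      (0 : Fin 1)).toContinuousLinearEquiv.differentiableAt).comp (f p) hα
  have h := extDeriv_pullback hω hf (by
    rw [minSmoothness_of_isRCLikeNormedField]
    exact WithTop.coe_le_coe.2 (le_top : (2 : ℕ∞) ≤ ⊤))
  have h2 := congrArg (fun A => A ![u, v]) h
  rw [dForm, dForm]
  refine Eq.trans ?_ (h2.trans ?_)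
  · congr 1
  · rw [ContinuousAlternatingMap.compContinuousLinearMap_apply]
    congr 1
    ext i
    fin_cases i <;> rfl

end ContactTorus

end

noncomputable section

namespace ContactTorus

/-! ### Smoothness of parametric integrals and of inverse maps, and a cutoff function -/

theorem hasFDerivAt_parametric_integral {X F : Type*} [NormedAddCommGroup X] [NormedSpace ℝ X]
    [ProperSpace X] [NormedAddCommGroup F] [NormedSpace ℝ F] [CompleteSpace F] {f : X → ℝ → F}
    (hf : ContDiff ℝ 1 (Function.uncurry f)) (a b : ℝ) (x : X) :
    HasFDerivAt (fun x => ∫ r in a..b, f x r)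
      (∫ r in a..b, fderiv ℝ (fun y => f y r) x) x := by
  have hc : Continuous (Function.uncurry f) := hf.continuous
  have hswap : ContDiff ℝ 1 (Function.uncurry fun (q : X × ℝ) (y : X) => f y q.2) :=
    hf.comp (contDiff_snd.prodMk (contDiff_snd.comp contDiff_fst))
  have hc' : Continuous (fun q : X × ℝ => fderiv ℝ (fun y => f y q.2) q.1) :=
    (hswap.fderiv (contDiff_fst (n := 0)) (by simp)).continuous
  obtain ⟨C, hC⟩ := ((isCompact_closedBall x 1).prod (isCompact_uIcc (a := a) (b := b))).bddAbove_image
    (f := fun q : X × ℝ => ‖fderiv ℝ (fun y => f y q.2) q.1‖) hc'.norm.continuousOn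
  refine (intervalIntegral.hasFDerivAt_integral_of_dominated_of_fderiv_le (μ := volume)
    (s := closedBall x 1) (bound := fun _ => C) (F := f)
    (F' := fun x r => fderiv ℝ (fun y => f y r) x) (closedBall_mem_nhds x one_pos) ?_ ?_ ?_ ?_ ?_ ?_)
  · exact Filter.Eventually.of_forall fun y =>
      (hc.comp (Continuous.prodMk_right y)).aestronglyMeasurable
  · exact (hc.comp (Continuous.prodMk_right x)).intervalIntegrable _ _
  · exact (hc'.comp (Continuous.prodMk_right x)).aestronglyMeasurable
  · refine Filter.Eventually.of_forall fun r hr y hy => ?_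
    exact hC ⟨(y, r), ⟨hy, uIoc_subset_uIcc hr⟩, rfl⟩
  · exact intervalIntegrable_const
  · refine Filter.Eventually.of_forall fun r _ y _ => ?_
    have : ContDiff ℝ 1 (fun y => f y r) := hf.comp (contDiff_id.prodMk contDiff_const)
    exact (this.differentiable (by simp) y).hasFDerivAt

theorem contDiff_parametric_integral {X : Type*} [NormedAddCommGroup X] [NormedSpace ℝ X]
    [FiniteDimensional ℝ X] {f : X → ℝ → ℝ} (hf : ContDiff ℝ ∞ (Function.uncurry f)) (a b : ℝ) :
    ContDiff ℝ ∞ (fun x => ∫ r in a..b, f x r) := by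
  have : ProperSpace X := FiniteDimensional.proper_real X
  refine contDiff_infty.2 fun n => ?_
  have key : ∀ (n : ℕ) (f : X → ℝ → ℝ), ContDiff ℝ ∞ (Function.uncurry f) →
      ContDiff ℝ n (fun x => ∫ r in a..b, f x r) := by
    intro n
    induction n with
    | zero =>
      intro f hf
      exact contDiff_zero.2 (intervalIntegral.continuous_parametric_intervalIntegral_of_continuous'
        hf.continuous a b)
    | succ n ih =>
      intro f hf
      have hd := hasFDerivAt_parametric_integral (hf.of_le (by simp)) a b
      push_cast
      refine contDiff_succ_iff_fderiv.2 ⟨fun x => (hd x).differentiableAt, by simp, ?_⟩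
      have hswap : ContDiff ℝ ∞ (Function.uncurry fun (q : X × ℝ) (y : X) => f y q.2) :=
        hf.comp (contDiff_snd.prodMk (contDiff_snd.comp contDiff_fst))
      have hs : ContDiff ℝ ∞ (fun q : X × ℝ => fderiv ℝ (fun y => f y q.2) q.1) :=
        hswap.fderiv contDiff_fst (by simp)
      -- In finite dimension it suffices to test the derivative on fixed vectors; this keeps the
      -- integrand real-valued, so that the induction hypothesis applies.
      refine contDiff_clm_apply_iff.2 fun v => ?_
      have hv : (fun x => fderiv ℝ (fun x => ∫ r in a..b, f x r) x v) =
          fun x => ∫ r in a..b, fderiv ℝ (fun y => f y r) x v := by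
        funext x
        rw [(hd x).fderiv, ContinuousLinearMap.intervalIntegral_apply]
        exact (hs.continuous.comp (Continuous.prodMk_right x)).intervalIntegrable _ _
      rw [hv]
      exact ih _ (hs.clm_apply contDiff_const)
  exact key n f hf

/-- A smooth bijection with injective derivatives has a smooth inverse. -/
theorem contDiff_inverse {X : Type*} [NormedAddCommGroup X] [NormedSpace ℝ X]
    [FiniteDimensional ℝ X] {f g : X → X} (hf : ContDiff ℝ ∞ f) (hgf : ∀ x, g (f x) = x)
    (hfg : ∀ x, f (g x) = x) (hinj : ∀ x, Function.Injective (fderiv ℝ f x)) :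
    ContDiff ℝ ∞ g := by
  have : CompleteSpace X := FiniteDimensional.complete ℝ X
  let e : X → X ≃L[ℝ] X := fun x =>
    (LinearEquiv.ofInjectiveEndo (fderiv ℝ f x).toLinearMap (hinj x)).toContinuousLinearEquiv
  have he : ∀ x, (e x : X →L[ℝ] X) = fderiv ℝ f x := fun x => by
    ext v
    rfl
  have hd : ∀ x, HasStrictFDerivAt f (e x : X →L[ℝ] X) x := fun x => by
    rw [he]
    exact hf.contDiffAt.hasStrictFDerivAt (by simp)
  have ho : IsOpenMap f := isOpenMap_of_hasStrictFDerivAt_equiv hd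
  let E : X ≃ X := ⟨f, g, hgf, hfg⟩
  let H : X ≃ₜ X := E.toHomeomorphOfContinuousOpen hf.continuous ho
  exact H.contDiff_symm (fun x => (hd x).hasFDerivAt) hf

theorem fderiv_injective_of_leftInverse {X Y : Type*} [NormedAddCommGroup X] [NormedSpace ℝ X]
    [NormedAddCommGroup Y] [NormedSpace ℝ Y] {f : X → Y} {g : Y → X} (hgf : ∀ x, g (f x) = x)
    {x : X} (hf : DifferentiableAt ℝ f x) (hg : DifferentiableAt ℝ g (f x)) :
    Function.Injective (fderiv ℝ f x) := by
  have h1 : HasFDerivAt (fun x => g (f x)) ((fderiv ℝ g (f x)).comp (fderiv ℝ f x)) x :=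
    hg.hasFDerivAt.comp x hf.hasFDerivAt
  have h2 : HasFDerivAt (fun x => g (f x)) (ContinuousLinearMap.id ℝ X) x := by
    simp only [hgf]
    exact hasFDerivAt_id x
  have h3 := h1.unique h2
  exact Function.LeftInverse.injective (g := fderiv ℝ g (f x)) fun v => by
    simpa using congrArg (fun A : X →L[ℝ] X => A v) h3

/-- A smooth step function with controlled slope. -/
theorem exists_step {L δ : ℝ} (hδ : 0 < δ) (hδL : δ ≤ L) :
    ∃ (a : ℝ → ℝ) (ε : ℝ), 0 < ε ∧ ContDiff ℝ ∞ a ∧ (∀ s ≤ ε, a s = 0) ∧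
      (∀ s, L - ε ≤ s → a s = 1) ∧ (∀ s, 0 ≤ deriv a s) ∧ ∀ s, deriv a s * (L - δ) < 1 := by
  -- The bump `ρ` below equals 1 on `[2ε, L - 2ε]`, so its integral `I` is at least `L - 4ε = L -
  -- δ/2 > L - δ`. The normalised primitive of `ρ` then has slope at most `1 / I`.
  set ε := δ / 8 with hε
  have hε0 : 0 < ε := by positivity
  let ρ : ℝ → ℝ := fun s =>
    Real.smoothTransition ((s - ε) / ε) * Real.smoothTransition ((L - ε - s) / ε)
  have hρ : ContDiff ℝ ∞ ρ :=
    (Real.smoothTransition.contDiff.comp ((contDiff_id.sub contDiff_const).div_const _)).mul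
      (Real.smoothTransition.contDiff.comp ((contDiff_const.sub contDiff_id).div_const _))
  have hρ0 : ∀ s, 0 ≤ ρ s := fun s =>
    mul_nonneg (Real.smoothTransition.nonneg _) (Real.smoothTransition.nonneg _)
  have hρ1 : ∀ s, ρ s ≤ 1 := fun s =>
    mul_le_one₀ (Real.smoothTransition.le_one _) (Real.smoothTransition.nonneg _)
      (Real.smoothTransition.le_one _)
  have hρl : ∀ s ≤ ε, ρ s = 0 := fun s hs => by
    have : (s - ε) / ε ≤ 0 := div_nonpos_of_nonpos_of_nonneg (by linarith) hε0.le
    simp [ρ, Real.smoothTransition.zero_of_nonpos this]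
  have hρr : ∀ s, L - ε ≤ s → ρ s = 0 := fun s hs => by
    have : (L - ε - s) / ε ≤ 0 := div_nonpos_of_nonpos_of_nonneg (by linarith) hε0.le
    simp [ρ, Real.smoothTransition.zero_of_nonpos this]
  have hρm : ∀ s ∈ Icc (2 * ε) (L - 2 * ε), ρ s = 1 := fun s hs => by
    have h1 : 1 ≤ (s - ε) / ε := by rw [le_div_iff₀ hε0]; linarith [hs.1]
    have h2 : 1 ≤ (L - ε - s) / ε := by rw [le_div_iff₀ hε0]; linarith [hs.2]
    simp [ρ, Real.smoothTransition.one_of_one_le h1, Real.smoothTransition.one_of_one_le h2]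
  have hint : ∀ x y, IntervalIntegrable ρ volume x y := fun x y =>
    hρ.continuous.intervalIntegrable x y
  set I := ∫ x in (0 : ℝ)..L, ρ x with hI
  have hIge : L - 4 * ε ≤ I := by
    have h1 : ∫ x in (2 * ε)..(L - 2 * ε), ρ x = L - 4 * ε := by
      rw [intervalIntegral.integral_congr (g := fun _ => (1 : ℝ))]
      · simp
        ring
      · rw [uIcc_of_le (by linarith)]
        exact hρm
    rw [← h1]
    refine intervalIntegral.integral_mono_interval (by linarith) (by linarith) (by linarith) ?_
      (hint _ _)
    exact Filter.Eventually.of_forall hρ0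
  have hI0 : L - δ < I := by linarith
  have hIpos : 0 < I := by linarith
  have hd : ∀ s, HasDerivAt (fun s => (∫ x in (0 : ℝ)..s, ρ x) / I) (ρ s / I) s := fun s =>
    (intervalIntegral.integral_hasDerivAt_right (hint _ _)
      (hρ.continuous.stronglyMeasurableAtFilter _ _) hρ.continuous.continuousAt).div_const I
  have hderiv : deriv (fun s => (∫ x in (0 : ℝ)..s, ρ x) / I) = fun s => ρ s / I :=
    funext fun s => (hd s).deriv
  refine ⟨fun s => (∫ x in (0 : ℝ)..s, ρ x) / I, ε, hε0, ?_, ?_, ?_, ?_, ?_⟩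
  · rw [contDiff_infty_iff_deriv, hderiv]
    exact ⟨fun s => (hd s).differentiableAt, hρ.div_const I⟩
  · intro s hs
    have : ∫ x in (0 : ℝ)..s, ρ x = 0 := by
      rw [intervalIntegral.integral_congr (g := fun _ => (0 : ℝ))]
      · simp
      · intro x hx
        exact hρl x (hx.2.trans (max_le hε0.le hs))
    simp [this]
  · intro s hs
    have : ∫ x in L..s, ρ x = 0 := by
      rw [intervalIntegral.integral_congr (g := fun _ => (0 : ℝ))]
      · simp
      · intro x hx
        exact hρr x ((le_min (by linarith) hs).trans hx.1)
    have h2 := intervalIntegral.integral_add_adjacent_intervals (hint 0 L) (hint L s)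
    rw [this, add_zero] at h2
    simp only
    rw [← h2, ← hI, div_self hIpos.ne']
  · intro s
    rw [hderiv]
    exact div_nonneg (hρ0 s) hIpos.le
  · intro s
    rw [hderiv]
    simp only
    rw [div_mul_eq_mul_div, div_lt_one hIpos]
    refine lt_of_le_of_lt ?_ hI0
    exact mul_le_of_le_one_left (by linarith) (hρ1 s)

end ContactTorus

end

noncomputable section

namespace ContactTorus

/-! ### Extension of the isotopy to the whole space -/

/-- A smooth family of compactly supported diffeomorphisms of `ℝ^{2m}`, parametrised by `ℝ` and
starting at the identity, with their inverses and actions. -/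
structure GlobalIsotopy (m : ℕ) where
  /-- the diffeomorphisms -/
  Φ : ℝ → E m → E m
  /-- their inverses -/
  Ξ : ℝ → E m → E m
  /-- their actions -/
  σ : ℝ → E m → ℝ
  /-- a radius beyond which the family is trivial -/
  r : ℝ
  r_pos : 0 < r
  r_lt_one : r < 1
  contDiff_Φ : ContDiff ℝ ∞ (Function.uncurry Φ)
  contDiff_Ξ : ContDiff ℝ ∞ (Function.uncurry Ξ)
  contDiff_σ : ContDiff ℝ ∞ (Function.uncurry σ)
  Ξ_Φ : ∀ t z, Ξ t (Φ t z) = z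
  Φ_Ξ : ∀ t z, Φ t (Ξ t z) = z
  fderiv_σ : ∀ t z, fderiv ℝ (σ t) z = (liouville (Φ t z)).comp (fderiv ℝ (Φ t) z) - liouville z
  Φ_zero : ∀ z, Φ 0 z = z
  σ_zero : ∀ z, σ 0 z = 0
  Φ_far : ∀ t z, r < ‖z‖ → Φ t z = z
  σ_far : ∀ t z, r < ‖z‖ → σ t z = 0

/-- The partial derivative of a smooth map in its second argument is smooth. -/
theorem contDiff_fderiv_snd {T X Y : Type*} [NormedAddCommGroup T] [NormedSpace ℝ T]
    [NormedAddCommGroup X] [NormedSpace ℝ X] [NormedAddCommGroup Y] [NormedSpace ℝ Y]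
    {f : T → X → Y} (hf : ContDiff ℝ ∞ (Function.uncurry f)) :
    ContDiff ℝ ∞ (fun q : T × X => fderiv ℝ (f q.1) q.2) := by
  have h1 : ContDiff ℝ ∞ (fun p : (T × X) × X => (p.1.1, p.2)) :=
    (contDiff_fst.comp contDiff_fst).prodMk contDiff_snd
  have h2 : ContDiff ℝ ∞ (Function.uncurry fun (q : T × X) => f q.1) := hf.comp h1
  exact h2.fderiv contDiff_snd (by simp)

/-- The action is constant on the connected annulus where `φ` is the identity, and it vanishes near
the boundary. Hence one radius serves all times, whereas `zero_near` provides a radius for each map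
separately. -/
theorem IsAction.eq_zero {m : ℕ} (hm : 1 ≤ m) {φ : E m → E m} {σ : E m → ℝ} (h : IsAction φ σ)
    {r : ℝ} (hr : 0 < r) (hφ : ∀ z ∈ B m, r < ‖z‖ → φ z = z) :
    ∀ z ∈ B m, r < ‖z‖ → σ z = 0 := by
  have hBo : IsOpen (B m) := isOpen_ball
  let A : Set (E m) := {z | r < ‖z‖ ∧ ‖z‖ < 1}
  have hAB : A ⊆ B m := fun z hz => by simpa [B] using hz.2
  have hAo : IsOpen A := (isOpen_lt continuous_const continuous_norm).inter
    (isOpen_lt continuous_norm continuous_const)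
  have h0 : EqOn (fderiv ℝ σ) 0 A := by
    intro z hz
    have hid : φ =ᶠ[𝓝 z] id := by
      filter_upwards [hAo.mem_nhds hz] with w hw
      exact hφ w (hAB hw) hw.1
    rw [h.fderiv_eq z (hAB hz), hid.fderiv_eq, hid.eq_of_nhds, fderiv_id]
    ext v
    simp
  obtain ⟨c, hc⟩ := hAo.exists_is_const_of_fderiv_eq_zero (isPreconnected_annulus hm hr)
    ((h.contDiffOn.differentiableOn (by simp)).mono hAB) h0
  obtain ⟨r', hr1', hr'⟩ := h.zero_near
  intro z hz hrz
  have hz1 : ‖z‖ < 1 := by simpa [B] using hz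
  obtain ⟨t, ht, ht1⟩ := exists_between (max_lt hr1' hz1)
  have ht0 : ‖z‖ < t := lt_of_le_of_lt (le_max_right _ _) ht
  have ht' : r' < t := lt_of_le_of_lt (le_max_left _ _) ht
  let z₀ : E m := EuclideanSpace.single (⟨0, hm⟩, 0) t
  have hz₀ : ‖z₀‖ = t := by simp [z₀, abs_of_pos ((norm_nonneg z).trans_lt ht0)]
  have hz₀B : z₀ ∈ B m := by simpa [B, hz₀] using ht1
  rw [hc z ⟨hrz, hz1⟩, ← hc z₀ ⟨by rw [hz₀]; linarith, by rw [hz₀]; exact ht1⟩]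
  exact hr' z₀ hz₀B (by rw [hz₀]; exact ht')

theorem exists_radius {m : ℕ} {K : Set (E m)} (hK : IsCompact K) (hKB : K ⊆ B m) :
    ∃ r : ℝ, 0 < r ∧ r < 1 ∧ ∀ z ∈ K, ‖z‖ ≤ r := by
  rcases K.eq_empty_or_nonempty with rfl | hne
  · exact ⟨1 / 2, by norm_num, by norm_num, by simp⟩
  · obtain ⟨z, hz, hmax⟩ := hK.exists_isMaxOn hne continuous_norm.continuousOn
    have hz1 : ‖z‖ < 1 := by simpa [B] using hKB hz
    refine ⟨(‖z‖ + 1) / 2, by positivity, by linarith, fun w hw => ?_⟩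
    have : ‖w‖ ≤ ‖z‖ := hmax hw
    linarith

open Classical in
/-- The extension of an isotopy by the identity, with time reparametrised smoothly by `ℝ`. -/
def extendIsotopy {m : ℕ} (φ : ℝ → E m → E m) (t : ℝ) (z : E m) : E m :=
  if z ∈ B m then φ (Real.smoothTransition t) z else z

open Classical in
/-- The extension of the actions by zero, with time reparametrised smoothly by `ℝ`. -/
def extendAction {m : ℕ} (φ : ℝ → E m → E m) (t : ℝ) (z : E m) : ℝ :=
  if z ∈ B m then action (φ (Real.smoothTransition t)) z else 0

theorem smoothTransition_mem (t : ℝ) : Real.smoothTransition t ∈ Icc (0 : ℝ) 1 :=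
  ⟨Real.smoothTransition.nonneg t, Real.smoothTransition.le_one t⟩

section Extend

variable {m : ℕ} {φ : ℝ → E m → E m}

theorem extendIsotopy_of_mem (t : ℝ) {z : E m} (hz : z ∈ B m) :
    extendIsotopy φ t z = φ (Real.smoothTransition t) z := if_pos hz

theorem extendAction_of_mem (t : ℝ) {z : E m} (hz : z ∈ B m) :
    extendAction φ t z = action (φ (Real.smoothTransition t)) z := if_pos hz

theorem extendIsotopy_far {r : ℝ}
    (hr : ∀ t ∈ Icc (0 : ℝ) 1, ∀ z ∈ B m, r < ‖z‖ → φ t z = z) (t : ℝ) {z : E m} (hz : r < ‖z‖) :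
    extendIsotopy φ t z = z := by
  unfold extendIsotopy
  split_ifs with h
  · exact hr _ (smoothTransition_mem t) z h hz
  · rfl

theorem lt_norm_of_notMem {r : ℝ} (hr1 : r < 1) {z : E m} (hz : z ∉ B m) : r < ‖z‖ := by
  have : 1 ≤ ‖z‖ := by simpa [B] using hz
  linarith

/-- The reparametrisation sends all of `ℝ` into `[0, 1]`, where smoothness is given. In space, the
extension by the identity is smooth because the supports stay within radius `r < 1`. -/
theorem contDiff_extendIsotopy (hφ : IsCompSymplIsotopy φ) {r : ℝ} (hr1 : r < 1)
    (hr : ∀ t ∈ Icc (0 : ℝ) 1, ∀ z ∈ B m, r < ‖z‖ → φ t z = z) :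
    ContDiff ℝ ∞ (Function.uncurry (extendIsotopy φ)) := by
  have hBo : IsOpen (B m) := isOpen_ball
  rw [contDiff_iff_contDiffAt]
  rintro ⟨t, z⟩
  by_cases hz : z ∈ B m
  · have h1 : ContDiffOn ℝ ∞ (fun q : ℝ × E m => φ (Real.smoothTransition q.1) q.2)
        (univ ×ˢ B m) :=
      hφ.contDiffOn.comp (f := fun q : ℝ × E m => (Real.smoothTransition q.1, q.2))
        ((Real.smoothTransition.contDiff.comp contDiff_fst).prodMk contDiff_snd).contDiffOn
        fun q hq => ⟨smoothTransition_mem q.1, hq.2⟩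
    have hmem : (univ : Set ℝ) ×ˢ B m ∈ 𝓝 (t, z) :=
      (isOpen_univ.prod hBo).mem_nhds ⟨mem_univ _, hz⟩
    refine (h1.contDiffAt hmem).congr_of_eventuallyEq ?_
    filter_upwards [hmem] with q hq
    exact extendIsotopy_of_mem q.1 hq.2
  · have hmem : {q : ℝ × E m | r < ‖q.2‖} ∈ 𝓝 (t, z) :=
      (isOpen_lt continuous_const continuous_snd.norm).mem_nhds (lt_norm_of_notMem hr1 hz)
    refine contDiffAt_snd.congr_of_eventuallyEq ?_
    filter_upwards [hmem] with q hq
    exact extendIsotopy_far hr q.1 hq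

theorem extendIsotopy_bijective (hφ : IsCompSymplIsotopy φ) (t : ℝ) :
    Function.Bijective (extendIsotopy φ t) := by
  have hb := (hφ.symplecto _ (smoothTransition_mem t)).bijOn
  have hmem : ∀ z, extendIsotopy φ t z ∈ B m ↔ z ∈ B m := fun z => by
    unfold extendIsotopy
    split_ifs with h
    · exact iff_of_true (hb.mapsTo h) h
    · exact Iff.rfl
  constructor
  · intro z w h
    by_cases hz : z ∈ B m
    · have hw : w ∈ B m := (hmem w).1 (h ▸ (hmem z).2 hz)
      rw [extendIsotopy_of_mem t hz, extendIsotopy_of_mem t hw] at h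
      exact hb.injOn hz hw h
    · have hw : w ∉ B m := fun hw => hz ((hmem z).1 (h ▸ (hmem w).2 hw))
      simpa [extendIsotopy, hz, hw] using h
  · intro w
    by_cases hw : w ∈ B m
    · obtain ⟨z, hz, hzw⟩ := hb.surjOn hw
      exact ⟨z, (extendIsotopy_of_mem t hz).trans hzw⟩
    · exact ⟨w, by simp [extendIsotopy, hw]⟩

theorem fderiv_extendIsotopy_injective (hφ : IsCompSymplIsotopy φ) {r : ℝ} (hr1 : r < 1)
    (hr : ∀ t ∈ Icc (0 : ℝ) 1, ∀ z ∈ B m, r < ‖z‖ → φ t z = z) (t : ℝ) (z : E m) :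
    Function.Injective (fderiv ℝ (extendIsotopy φ t) z) := by
  have hBo : IsOpen (B m) := isOpen_ball
  rw [injective_iff_map_eq_zero]
  intro v hv
  by_cases hz : z ∈ B m
  · have h1 : extendIsotopy φ t =ᶠ[𝓝 z] φ (Real.smoothTransition t) := by
      filter_upwards [hBo.mem_nhds hz] with w hw
      exact extendIsotopy_of_mem t hw
    rw [h1.fderiv_eq] at hv
    refine eq_zero_of_stdSymplectic fun u => ?_
    rw [← (hφ.symplecto _ (smoothTransition_mem t)).symplectic z hz v u, hv]
    simp [stdSymplectic]
  · have h1 : extendIsotopy φ t =ᶠ[𝓝 z] id := by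
      filter_upwards [(isOpen_lt continuous_const continuous_norm).mem_nhds
        (lt_norm_of_notMem hr1 hz)] with w hw
      exact extendIsotopy_far hr t hw
    rw [h1.fderiv_eq, fderiv_id] at hv
    simpa using hv

/-- The inverse function theorem is applied to `(t, z) ↦ (t, φ_t z)` rather than to each `φ_t`,
which yields smoothness of the inverses in `t` as well. -/
theorem exists_contDiff_inverse (hφ : IsCompSymplIsotopy φ) {r : ℝ} (hr1 : r < 1)
    (hr : ∀ t ∈ Icc (0 : ℝ) 1, ∀ z ∈ B m, r < ‖z‖ → φ t z = z) :
    ∃ Ξ : ℝ → E m → E m, ContDiff ℝ ∞ (Function.uncurry Ξ) ∧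
      (∀ t z, Ξ t (extendIsotopy φ t z) = z) ∧ ∀ t z, extendIsotopy φ t (Ξ t z) = z := by
  let e : ∀ t, E m ≃ E m := fun t => Equiv.ofBijective _ (extendIsotopy_bijective hφ t)
  have h1 : ∀ t z, (e t).symm (extendIsotopy φ t z) = z := fun t z => (e t).symm_apply_apply z
  have h2 : ∀ t z, extendIsotopy φ t ((e t).symm z) = z := fun t z => (e t).apply_symm_apply z
  have hs := contDiff_extendIsotopy hφ hr1 hr
  have hf : ContDiff ℝ ∞ (fun q : ℝ × E m => (q.1, extendIsotopy φ q.1 q.2)) :=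
    contDiff_fst.prodMk hs
  have hinv := contDiff_inverse (f := fun q : ℝ × E m => (q.1, extendIsotopy φ q.1 q.2))
    (g := fun q => (q.1, (e q.1).symm q.2)) hf (fun q => by simp [h1]) (fun q => by simp [h2]) ?_
  · exact ⟨fun t => (e t).symm, contDiff_snd.comp hinv, h1, h2⟩
  · rintro ⟨t, z⟩
    rw [injective_iff_map_eq_zero]
    rintro ⟨a, v⟩ hv
    have hd : HasFDerivAt (Function.uncurry (extendIsotopy φ))
        (fderiv ℝ (Function.uncurry (extendIsotopy φ)) (t, z)) (t, z) :=
      (hs.differentiable (by simp) _).hasFDerivAt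
    have hd1 : HasFDerivAt (fun q : ℝ × E m => (q.1, extendIsotopy φ q.1 q.2)) _ (t, z) :=
      hasFDerivAt_fst.prodMk hd
    rw [hd1.fderiv] at hv
    simp only [ContinuousLinearMap.prod_apply, ContinuousLinearMap.coe_fst', Prod.mk_eq_zero] at hv
    obtain ⟨rfl, hv⟩ := hv
    have hd2 : HasFDerivAt (extendIsotopy φ t) _ z :=
      hd.comp z ((hasFDerivAt_const t z).prodMk (hasFDerivAt_id z))
    have : fderiv ℝ (extendIsotopy φ t) z v = 0 := by
      rw [hd2.fderiv]
      simpa using hv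
    have := (injective_iff_map_eq_zero _).1 (fderiv_extendIsotopy_injective hφ hr1 hr t z) v this
    simp [this]

theorem isAction_extend (hm : 1 ≤ m) (hφ : IsCompSymplIsotopy φ) (t : ℝ) :
    IsAction (φ (Real.smoothTransition t)) (action (φ (Real.smoothTransition t))) :=
  action_spec hm (hφ.symplecto _ (smoothTransition_mem t))

theorem extendAction_far (hm : 1 ≤ m) (hφ : IsCompSymplIsotopy φ) {r : ℝ} (hr0 : 0 < r)
    (hr : ∀ t ∈ Icc (0 : ℝ) 1, ∀ z ∈ B m, r < ‖z‖ → φ t z = z) (t : ℝ) {z : E m} (hz : r < ‖z‖) :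
    extendAction φ t z = 0 := by
  unfold extendAction
  split_ifs with h
  · exact (isAction_extend hm hφ t).eq_zero hm hr0 (hr _ (smoothTransition_mem t)) z h hz
  · rfl

theorem fderiv_extendAction (hm : 1 ≤ m) (hφ : IsCompSymplIsotopy φ) {r : ℝ} (hr0 : 0 < r)
    (hr1 : r < 1) (hr : ∀ t ∈ Icc (0 : ℝ) 1, ∀ z ∈ B m, r < ‖z‖ → φ t z = z) (t : ℝ) (z : E m) :
    fderiv ℝ (extendAction φ t) z =
      (liouville (extendIsotopy φ t z)).comp (fderiv ℝ (extendIsotopy φ t) z) - liouville z := by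
  have hBo : IsOpen (B m) := isOpen_ball
  by_cases hz : z ∈ B m
  · have h1 : extendIsotopy φ t =ᶠ[𝓝 z] φ (Real.smoothTransition t) := by
      filter_upwards [hBo.mem_nhds hz] with w hw
      exact extendIsotopy_of_mem t hw
    have h2 : extendAction φ t =ᶠ[𝓝 z] action (φ (Real.smoothTransition t)) := by
      filter_upwards [hBo.mem_nhds hz] with w hw
      exact extendAction_of_mem t hw
    rw [h1.fderiv_eq, h2.fderiv_eq, h1.eq_of_nhds, (isAction_extend hm hφ t).fderiv_eq z hz]
  · have hU := (isOpen_lt continuous_const continuous_norm).mem_nhds (lt_norm_of_notMem hr1 hz)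
    have h1 : extendIsotopy φ t =ᶠ[𝓝 z] id := by
      filter_upwards [hU] with w hw
      exact extendIsotopy_far hr t hw
    have h2 : extendAction φ t =ᶠ[𝓝 z] fun _ => 0 := by
      filter_upwards [hU] with w hw
      exact extendAction_far hm hφ hr0 hr t hw
    rw [h1.fderiv_eq, h2.fderiv_eq, h1.eq_of_nhds]
    ext v
    simp

theorem differentiable_extendAction (hm : 1 ≤ m) (hφ : IsCompSymplIsotopy φ) {r : ℝ} (hr0 : 0 < r)
    (hr1 : r < 1) (hr : ∀ t ∈ Icc (0 : ℝ) 1, ∀ z ∈ B m, r < ‖z‖ → φ t z = z) (t : ℝ) :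
    Differentiable ℝ (extendAction φ t) := by
  have hBo : IsOpen (B m) := isOpen_ball
  intro z
  by_cases hz : z ∈ B m
  · have h2 : extendAction φ t =ᶠ[𝓝 z] action (φ (Real.smoothTransition t)) := by
      filter_upwards [hBo.mem_nhds hz] with w hw
      exact extendAction_of_mem t hw
    exact (((isAction_extend hm hφ t).contDiffOn.contDiffAt (hBo.mem_nhds hz)).differentiableAt
      (by simp)).congr_of_eventuallyEq h2
  · have hU := (isOpen_lt continuous_const continuous_norm).mem_nhds (lt_norm_of_notMem hr1 hz)
    have h2 : extendAction φ t =ᶠ[𝓝 z] fun _ => 0 := by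
      filter_upwards [hU] with w hw
      exact extendAction_far hm hφ hr0 hr t hw
    exact (differentiableAt_const 0).congr_of_eventuallyEq h2

/-- The actions are chosen separately for each time, so their smoothness in `t` is not automatic.
Their differentials depend smoothly on `(t, z)`, and integrating these along rays from the origin
recovers the actions up to a constant depending on `t`. -/
theorem contDiff_extendAction (hm : 1 ≤ m) (hφ : IsCompSymplIsotopy φ) {r : ℝ} (hr0 : 0 < r)
    (hr1 : r < 1) (hr : ∀ t ∈ Icc (0 : ℝ) 1, ∀ z ∈ B m, r < ‖z‖ → φ t z = z) :
    ContDiff ℝ ∞ (Function.uncurry (extendAction φ)) := by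
  obtain ⟨l, hl⟩ := exists_liouville_eq m
  have hs := contDiff_extendIsotopy hφ hr1 hr
  have hd := differentiable_extendAction hm hφ hr0 hr1 hr
  let α : ℝ × E m → E m →L[ℝ] ℝ := fun q => fderiv ℝ (extendAction φ q.1) q.2
  have hα : ContDiff ℝ ∞ α := by
    have : α = fun q : ℝ × E m => (l (extendIsotopy φ q.1 q.2)).comp
        (fderiv ℝ (extendIsotopy φ q.1) q.2) - l q.2 := by
      funext q
      simp only [α, fderiv_extendAction hm hφ hr0 hr1 hr, hl]
    rw [this]
    have hD : ContDiff ℝ ∞ (fun q : ℝ × E m => fderiv ℝ (extendIsotopy φ q.1) q.2) :=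
      contDiff_fderiv_snd hs
    exact ((l.contDiff.comp hs).clm_comp hD).sub (l.contDiff.comp contDiff_snd)
  let f : ℝ × E m → ℝ := fun q => ∫ ρ in (0 : ℝ)..1, α (q.1, ρ • q.2) q.2
  have hf : ContDiff ℝ ∞ f := by
    have h1 : ContDiff ℝ ∞ (fun p : (ℝ × E m) × ℝ => (p.1.1, p.2 • p.1.2)) :=
      (contDiff_fst.comp contDiff_fst).prodMk (contDiff_snd.smul (contDiff_snd.comp contDiff_fst))
    have h2 : ContDiff ℝ ∞ (fun p : (ℝ × E m) × ℝ => α (p.1.1, p.2 • p.1.2)) := hα.comp h1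
    have h3 : ContDiff ℝ ∞ (fun p : (ℝ × E m) × ℝ => p.1.2) := contDiff_snd.comp contDiff_fst
    have h4 : ContDiff ℝ ∞ (fun p : (ℝ × E m) × ℝ => α (p.1.1, p.2 • p.1.2) p.1.2) :=
      h2.clm_apply h3
    exact contDiff_parametric_integral (f := fun (q : ℝ × E m) ρ => α (q.1, ρ • q.2) q.2) h4 0 1
  have hfe : ∀ t z, f (t, z) = extendAction φ t z - extendAction φ t 0 := by
    intro t z
    have h1 : ∀ ρ : ℝ, HasDerivAt (fun ρ : ℝ => extendAction φ t (ρ • z)) (α (t, ρ • z) z) ρ := by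
      intro ρ
      have h : HasDerivAt (fun ρ : ℝ => extendAction φ t (ρ • z)) (α (t, ρ • z) ((1 : ℝ) • z)) ρ :=
        (hd t (ρ • z)).hasFDerivAt.comp_hasDerivAt (f := fun ρ : ℝ => ρ • z) ρ
          ((hasDerivAt_id ρ).smul_const z)
      rwa [one_smul] at h
    have hc : Continuous fun ρ : ℝ => α (t, ρ • z) z :=
      (hα.continuous.comp (by fun_prop)).clm_apply continuous_const
    have := intervalIntegral.integral_eq_sub_of_hasDerivAt (a := 0) (b := 1)
      (fun ρ _ => h1 ρ) (hc.intervalIntegrable _ _)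
    simpa using this
  -- All actions vanish at this unit vector, which fixes the constant of integration.
  let z₀ : E m := EuclideanSpace.single (⟨0, hm⟩, 0) 1
  have hz₀ : ‖z₀‖ = 1 := by simp [z₀]
  have heq : Function.uncurry (extendAction φ) = fun q : ℝ × E m => f q - f (q.1, z₀) := by
    funext ⟨t, z⟩
    rw [hfe, hfe, extendAction_far hm hφ hr0 hr t (z := z₀) (by rw [hz₀]; exact hr1)]
    simp
  rw [heq]
  exact hf.sub (hf.comp (contDiff_fst.prodMk contDiff_const))

theorem exists_globalIsotopy (hm : 1 ≤ m) (hφ : IsCompSymplIsotopy φ) :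
    ∃ g : GlobalIsotopy m, g.Φ = extendIsotopy φ ∧ g.σ = extendAction φ := by
  obtain ⟨K, hK, hKB, hKφ⟩ := hφ.compactSupport
  obtain ⟨r, hr0, hr1, hrK⟩ := exists_radius hK hKB
  have hr : ∀ t ∈ Icc (0 : ℝ) 1, ∀ z ∈ B m, r < ‖z‖ → φ t z = z := fun t ht z hz hrz =>
    hKφ t ht z hz fun h => absurd (hrK z h) (not_le.2 hrz)
  obtain ⟨Ξ, hΞ, hΞ1, hΞ2⟩ := exists_contDiff_inverse hφ hr1 hr
  have h0 : ∀ z, extendIsotopy φ 0 z = z := fun z => by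
    unfold extendIsotopy
    split_ifs with h
    · rw [Real.smoothTransition.zero, hφ.zero z h]
    · rfl
  refine ⟨{ Φ := extendIsotopy φ
            Ξ := Ξ
            σ := extendAction φ
            r := r
            r_pos := hr0
            r_lt_one := hr1
            contDiff_Φ := contDiff_extendIsotopy hφ hr1 hr
            contDiff_Ξ := hΞ
            contDiff_σ := contDiff_extendAction hm hφ hr0 hr1 hr
            Ξ_Φ := hΞ1
            Φ_Ξ := hΞ2
            fderiv_σ := fderiv_extendAction hm hφ hr0 hr1 hr
            Φ_zero := h0
            σ_zero := fun z => ?_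
            Φ_far := fun t z => extendIsotopy_far hr t
            σ_far := fun t z => extendAction_far hm hφ hr0 hr t }, rfl, rfl⟩
  unfold extendAction
  split_ifs with h
  · rw [Real.smoothTransition.zero]
    have h1 : IsAction (φ 0) (fun _ => (0 : ℝ)) := by
      refine ⟨contDiffOn_const, fun w hw => ?_, ⟨0, by norm_num, fun _ _ _ => rfl⟩⟩
      have hid : φ 0 =ᶠ[𝓝 w] id := by
        filter_upwards [(isOpen_ball : IsOpen (B m)).mem_nhds hw] with v hv
        exact hφ.zero v hv
      rw [hid.fderiv_eq, hid.eq_of_nhds, fderiv_id]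
      ext v
      simp
    exact (action_spec hm (hφ.symplecto 0 (by simp))).eqOn hm h1 h
  · rfl

/-- A uniform positive lower bound for the return times. -/
theorem exists_lower_bound (hm : 1 ≤ m) (hφ : IsCompSymplIsotopy φ) {L : ℝ} (hL : 0 < L)
    (hτ : ∀ t ∈ Icc (0 : ℝ) 1, ∀ z ∈ B m, 0 < action (φ t) z + L) :
    ∃ δ, 0 < δ ∧ δ ≤ L ∧ ∀ t z, δ ≤ extendAction φ t z + L := by
  obtain ⟨g, -, hσ⟩ := exists_globalIsotopy hm hφ
  have hpos : ∀ t z, 0 < extendAction φ t z + L := by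
    intro t z
    unfold extendAction
    split_ifs with h
    · exact hτ _ (smoothTransition_mem t) z h
    · simpa using hL
  have hc : Continuous fun q : ℝ × E m => extendAction φ q.1 q.2 + L := by
    have := g.contDiff_σ.continuous
    rw [hσ] at this
    exact this.add continuous_const
  obtain ⟨q, -, hq⟩ := ((isCompact_Icc (a := (0 : ℝ)) (b := 1)).prod
    (isCompact_closedBall (0 : E m) 1)).exists_isMinOn
      ⟨(0, 0), ⟨by simp, by simp⟩⟩ hc.continuousOn
  -- The value `L` in the minimum covers points outside the ball, where the extended action is 0,
  -- and ensures `δ ≤ L`, which `exists_step` requires.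
  refine ⟨min (extendAction φ q.1 q.2 + L) L, lt_min (hpos _ _) hL, min_le_right _ _, ?_⟩
  intro t z
  by_cases hz : z ∈ B m
  · have h1 : extendAction φ t z = extendAction φ (projIcc 0 1 zero_le_one t) z := by
      -- The reparametrised time is constant outside `[0, 1]`, so `t` may be clamped to the compact
      -- interval.
      rw [extendAction_of_mem t hz, extendAction_of_mem _ hz, Real.smoothTransition.projIcc]
    rw [h1]
    exact (min_le_left _ _).trans (hq (a := ((projIcc 0 1 zero_le_one t : ℝ), z))
      ⟨(projIcc 0 1 zero_le_one t).2, ball_subset_closedBall hz⟩)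
  · have : extendAction φ t z = 0 := if_neg hz
    rw [this, zero_add]
    exact min_le_right _ _

end Extend

end ContactTorus

end

noncomputable section

namespace ContactTorus

/-! ### The developing map of the mapping torus -/

/-- An isotopy together with a smooth step function whose slope is compatible with the return
times. -/
structure MappingTorus (m : ℕ) (L : ℝ) extends GlobalIsotopy m where
  /-- the step function -/
  a : ℝ → ℝ
  /-- the step function is constant outside `(ε, L - ε)` -/
  ε : ℝ
  /-- a lower bound for the return times -/
  δ : ℝ
  ε_pos : 0 < ε
  δ_pos : 0 < δ
  δ_le : ∀ t z, δ ≤ σ t z + L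
  contDiff_a : ContDiff ℝ ∞ a
  a_left : ∀ s ≤ ε, a s = 0
  a_right : ∀ s, L - ε ≤ s → a s = 1
  deriv_a_nonneg : ∀ s, 0 ≤ deriv a s
  deriv_a_lt : ∀ s, deriv a s * (L - δ) < 1

namespace MappingTorus

variable {m : ℕ} {L : ℝ} (g : MappingTorus m L)

theorem two_mul_ε_lt : 2 * g.ε < L := by
  by_contra! h
  have h1 := g.a_left g.ε le_rfl
  have h2 := g.a_right g.ε (by linarith)
  rw [h1] at h2
  exact zero_ne_one h2

theorem L_pos (g : MappingTorus m L) : 0 < L := by linarith [g.ε_pos, g.two_mul_ε_lt]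

/-- The deck transformation of the mapping torus. -/
def deck (t : ℝ) : Equiv.Perm (ℝ × E m) where
  toFun p := (p.1 + L + g.σ t (g.Ξ t p.2), g.Ξ t p.2)
  invFun p := (p.1 - L - g.σ t p.2, g.Φ t p.2)
  left_inv p := by
    ext1
    · simp only
      ring
    · exact g.Φ_Ξ t p.2
  right_inv p := by
    ext1
    · simp only [g.Ξ_Φ]
      ring
    · exact g.Ξ_Φ t p.2

/-- The developing map over `[0, L]`. -/
def dev₀ (t : ℝ) (p : ℝ × E m) : ℝ × E m :=
  (p.1 + g.a p.1 * g.σ t (g.Ξ (t * g.a p.1) p.2), g.Ξ (t * g.a p.1) p.2)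

/-- The developing map: the equivariant extension of `dev₀`. -/
def dev (t : ℝ) (p : ℝ × E m) : ℝ × E m :=
  (g.deck t ^ ⌊p.1 / L⌋) (g.dev₀ t (p.1 - ⌊p.1 / L⌋ * L, p.2))

theorem deck_apply (t : ℝ) (p : ℝ × E m) :
    g.deck t p = (p.1 + L + g.σ t (g.Ξ t p.2), g.Ξ t p.2) := rfl

theorem deck_inv_apply (t : ℝ) (p : ℝ × E m) :
    (g.deck t)⁻¹ p = (p.1 - L - g.σ t p.2, g.Φ t p.2) := rfl

theorem Ξ_zero (z : E m) : g.Ξ 0 z = z := by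
  have := g.Ξ_Φ 0 z
  rwa [g.Φ_zero] at this

theorem Ξ_far (t : ℝ) {z : E m} (hz : g.r < ‖z‖) : g.Ξ t z = z := by
  have := g.Ξ_Φ t z
  rwa [g.Φ_far t z hz] at this

/-! #### Smoothness -/

theorem contDiff_deck : ContDiff ℝ ∞ (fun q : ℝ × (ℝ × E m) => g.deck q.1 q.2) := by
  have h0 : ContDiff ℝ ∞ (fun q : ℝ × (ℝ × E m) => (q.1, q.2.2)) :=
    contDiff_fst.prodMk (contDiff_snd.comp contDiff_snd)
  have h1 : ContDiff ℝ ∞ (fun q : ℝ × (ℝ × E m) => g.Ξ q.1 q.2.2) := g.contDiff_Ξ.comp h0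
  have h2 : ContDiff ℝ ∞ (fun q : ℝ × (ℝ × E m) => g.σ q.1 (g.Ξ q.1 q.2.2)) :=
    g.contDiff_σ.comp (contDiff_fst.prodMk h1)
  have h3 : ContDiff ℝ ∞ (fun q : ℝ × (ℝ × E m) => q.2.1 + L) :=
    (contDiff_fst.comp contDiff_snd).add contDiff_const
  exact (h3.add h2).prodMk h1

theorem contDiff_deck_inv : ContDiff ℝ ∞ (fun q : ℝ × (ℝ × E m) => (g.deck q.1)⁻¹ q.2) := by
  have h0 : ContDiff ℝ ∞ (fun q : ℝ × (ℝ × E m) => (q.1, q.2.2)) :=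
    contDiff_fst.prodMk (contDiff_snd.comp contDiff_snd)
  have h1 : ContDiff ℝ ∞ (fun q : ℝ × (ℝ × E m) => g.Φ q.1 q.2.2) := g.contDiff_Φ.comp h0
  have h2 : ContDiff ℝ ∞ (fun q : ℝ × (ℝ × E m) => g.σ q.1 q.2.2) := g.contDiff_σ.comp h0
  have h3 : ContDiff ℝ ∞ (fun q : ℝ × (ℝ × E m) => q.2.1 - L) :=
    (contDiff_fst.comp contDiff_snd).sub contDiff_const
  exact (h3.sub h2).prodMk h1

theorem contDiff_deck_zpow (k : ℤ) :
    ContDiff ℝ ∞ (fun q : ℝ × (ℝ × E m) => (g.deck q.1 ^ k) q.2) := by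
  induction k using Int.induction_on with
  | zero => simpa using contDiff_snd
  | succ k ih =>
    simp only [zpow_add_one, Equiv.Perm.mul_apply]
    exact ih.comp (contDiff_fst.prodMk g.contDiff_deck)
  | pred k ih =>
    simp only [zpow_sub_one, Equiv.Perm.mul_apply]
    exact ih.comp (contDiff_fst.prodMk g.contDiff_deck_inv)

theorem contDiff_dev₀ : ContDiff ℝ ∞ (fun q : ℝ × (ℝ × E m) => g.dev₀ q.1 q.2) := by
  have hs : ContDiff ℝ ∞ (fun q : ℝ × (ℝ × E m) => q.2.1) := contDiff_fst.comp contDiff_snd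
  have ha : ContDiff ℝ ∞ (fun q : ℝ × (ℝ × E m) => g.a q.2.1) := g.contDiff_a.comp hs
  have h0 : ContDiff ℝ ∞ (fun q : ℝ × (ℝ × E m) => (q.1 * g.a q.2.1, q.2.2)) :=
    (contDiff_fst.mul ha).prodMk (contDiff_snd.comp contDiff_snd)
  have h1 : ContDiff ℝ ∞ (fun q : ℝ × (ℝ × E m) => g.Ξ (q.1 * g.a q.2.1) q.2.2) :=
    g.contDiff_Ξ.comp h0
  have h2 : ContDiff ℝ ∞ (fun q : ℝ × (ℝ × E m) => g.σ q.1 (g.Ξ (q.1 * g.a q.2.1) q.2.2)) :=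
    g.contDiff_σ.comp (contDiff_fst.prodMk h1)
  exact (hs.add (ha.mul h2)).prodMk h1

theorem dev₀_left (t : ℝ) {p : ℝ × E m} (hp : p.1 ≤ g.ε) : g.dev₀ t p = p := by
  simp [dev₀, g.a_left _ hp, g.Ξ_zero]

theorem dev₀_right (t : ℝ) {p : ℝ × E m} (hp : L - g.ε ≤ p.1) :
    g.dev₀ t p = g.deck t (p.1 - L, p.2) := by
  simp [dev₀, deck_apply, g.a_right _ hp]

/-- Near a multiple of `L` the two adjacent branches agree by `dev₀_left` and `dev₀_right`. The
formula for the `k`-th slab thus persists on an open neighbourhood of it, which makes `dev` smooth.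
-/
theorem dev_eq (t : ℝ) (k : ℤ) {p : ℝ × E m} (h1 : k * L - g.ε < p.1)
    (h2 : p.1 < (k + 1) * L + g.ε) :
    g.dev t p = (g.deck t ^ k) (g.dev₀ t (p.1 - k * L, p.2)) := by
  have hL := g.L_pos
  have hε := g.two_mul_ε_lt
  have hε0 := g.ε_pos
  set j := ⌊p.1 / L⌋ with hj
  have hj1 : (j : ℝ) * L ≤ p.1 := (le_div_iff₀ hL).1 (Int.floor_le _)
  have hj2 : p.1 < (j + 1) * L := (div_lt_iff₀ hL).1 (Int.lt_floor_add_one _)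
  have hle : j ≤ k + 1 := by
    have : (j : ℝ) * L < ((k + 2 : ℤ) : ℝ) * L := by push_cast; nlinarith
    have := Int.cast_lt.1 (lt_of_mul_lt_mul_right this hL.le)
    omega
  have hge : k - 1 ≤ j := by
    have : ((k - 1 : ℤ) : ℝ) * L < ((j + 1 : ℤ) : ℝ) * L := by push_cast; nlinarith
    have := Int.cast_lt.1 (lt_of_mul_lt_mul_right this hL.le)
    omega
  have hdev : g.dev t p = (g.deck t ^ j) (g.dev₀ t (p.1 - j * L, p.2)) := rfl
  rw [hdev]
  obtain h | h | h : j = k - 1 ∨ j = k ∨ j = k + 1 := by omega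
  · rw [h] at hj1 hj2 ⊢
    push_cast at hj1 hj2 ⊢
    rw [g.dev₀_left t (p := (p.1 - k * L, p.2)) (by simp only; linarith),
      g.dev₀_right t (by simp only; linarith), ← Equiv.Perm.mul_apply, ← zpow_add_one]
    congr 2
    · ring
    · simp only
      ring
  · rw [h]
  · rw [h] at hj1 hj2 ⊢
    push_cast at hj1 hj2 ⊢
    rw [g.dev₀_left t (by simp only; linarith),
      g.dev₀_right t (p := (p.1 - k * L, p.2)) (by simp only; linarith), ← Equiv.Perm.mul_apply,
      ← zpow_add_one]
    congr 2
    simp only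
    ring

theorem dev_eventuallyEq (q : ℝ × (ℝ × E m)) : ∃ k : ℤ,
    (fun q : ℝ × (ℝ × E m) => g.dev q.1 q.2) =ᶠ[𝓝 q]
      fun q => (g.deck q.1 ^ k) (g.dev₀ q.1 (q.2.1 - k * L, q.2.2)) := by
  have hL := g.L_pos
  have hε0 := g.ε_pos
  refine ⟨⌊q.2.1 / L⌋, ?_⟩
  set k := ⌊q.2.1 / L⌋ with hk
  have hj1 : (k : ℝ) * L ≤ q.2.1 := (le_div_iff₀ hL).1 (Int.floor_le _)
  have hj2 : q.2.1 < (k + 1) * L := (div_lt_iff₀ hL).1 (Int.lt_floor_add_one _)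
  have hc : Continuous fun q : ℝ × (ℝ × E m) => q.2.1 := by fun_prop
  filter_upwards [(isOpen_lt continuous_const hc).mem_nhds (show k * L - g.ε < q.2.1 by linarith),
    (isOpen_lt hc continuous_const).mem_nhds (show q.2.1 < (k + 1) * L + g.ε by linarith)]
    with q' h1 h2
  exact g.dev_eq q'.1 k h1 h2

theorem contDiff_dev : ContDiff ℝ ∞ (fun q : ℝ × (ℝ × E m) => g.dev q.1 q.2) := by
  rw [contDiff_iff_contDiffAt]
  intro q
  obtain ⟨k, hk⟩ := g.dev_eventuallyEq q
  refine ContDiffAt.congr_of_eventuallyEq (ContDiff.contDiffAt ?_) hk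
  have h1 : ContDiff ℝ ∞ (fun q : ℝ × (ℝ × E m) => (q.1, (q.2.1 - k * L, q.2.2))) :=
    contDiff_fst.prodMk (((contDiff_fst.comp contDiff_snd).sub contDiff_const).prodMk
      (contDiff_snd.comp contDiff_snd))
  have h2 : ContDiff ℝ ∞ (fun q : ℝ × (ℝ × E m) => g.dev₀ q.1 (q.2.1 - k * L, q.2.2)) :=
    g.contDiff_dev₀.comp h1
  exact (g.contDiff_deck_zpow k).comp (contDiff_fst.prodMk h2)

theorem contDiff_deck_zpow_apply (t : ℝ) (k : ℤ) : ContDiff ℝ ∞ ⇑(g.deck t ^ k) :=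
  (g.contDiff_deck_zpow k).comp (contDiff_const.prodMk contDiff_id)

theorem contDiff_dev₀_apply (t : ℝ) : ContDiff ℝ ∞ (g.dev₀ t) :=
  g.contDiff_dev₀.comp (contDiff_const.prodMk contDiff_id)

theorem contDiff_dev_apply (t : ℝ) : ContDiff ℝ ∞ (g.dev t) :=
  g.contDiff_dev.comp (contDiff_const.prodMk contDiff_id)

theorem differentiable_dev (t : ℝ) : Differentiable ℝ (g.dev t) :=
  (g.contDiff_dev_apply t).differentiable (by simp)

/-! #### Symmetries -/

theorem dev_add (t : ℝ) (p : ℝ × E m) : g.dev t (p.1 + L, p.2) = g.deck t (g.dev t p) := by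
  have hL := g.L_pos
  have h : ⌊(p.1 + L) / L⌋ = 1 + ⌊p.1 / L⌋ := by
    rw [add_div, div_self hL.ne', Int.floor_add_one, add_comm]
  simp only [dev, h]
  rw [zpow_one_add, Equiv.Perm.mul_apply]
  push_cast
  congr 4
  ring

theorem dev_of_abs_lt (t : ℝ) {p : ℝ × E m} (hp : |p.1| < g.ε) : g.dev t p = p := by
  have hL := g.L_pos
  rw [abs_lt] at hp
  rw [g.dev_eq t 0 (by simp; linarith) (by simp; linarith), g.dev₀_left t (by simp; linarith)]
  simp

theorem dev_eq_dev₀ (t : ℝ) {p : ℝ × E m} (h1 : -g.ε < p.1) (h2 : p.1 < L + g.ε) :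
    g.dev t p = g.dev₀ t p := by
  rw [g.dev_eq t 0 (by simpa using h1) (by simpa using h2)]
  simp

/-- Deck transformations commute with the flow of `∂_s`, so this flow descends to the quotient. -/
theorem deck_zpow_add (t : ℝ) (n : ℤ) (p : ℝ × E m) (c : ℝ) :
    (g.deck t ^ n) (p + (c, 0)) = (g.deck t ^ n) p + (c, 0) := by
  induction n using Int.induction_on generalizing p with
  | zero => simp
  | succ k ih =>
    simp only [zpow_add_one, Equiv.Perm.mul_apply]
    rw [← ih]
    congr 1
    simp only [deck_apply, Prod.mk_add_mk, Prod.fst_add, Prod.snd_add, add_zero]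
    congr 1
    ring
  | pred k ih =>
    simp only [zpow_sub_one, Equiv.Perm.mul_apply]
    rw [← ih]
    congr 1
    simp only [deck_inv_apply, Prod.mk_add_mk, Prod.fst_add, Prod.snd_add, add_zero]
    congr 1
    ring

theorem deck_zpow_of_fixed {t : ℝ} {z : E m} (hΞ : g.Ξ t z = z) (hσ : g.σ t z = 0) (n : ℤ) (s : ℝ) :
    (g.deck t ^ n) (s, z) = (s + n * L, z) := by
  have hΦ : g.Φ t z = z := by
    have := g.Φ_Ξ t z
    rwa [hΞ] at this
  induction n using Int.induction_on generalizing s with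
  | zero => simp
  | succ k ih =>
    rw [zpow_add_one, Equiv.Perm.mul_apply, deck_apply]
    simp only [hΞ, hσ, ih]
    push_cast
    congr 1
    ring
  | pred k ih =>
    rw [zpow_sub_one, Equiv.Perm.mul_apply, deck_inv_apply]
    simp only [hΦ, hσ, ih]
    push_cast
    congr 1
    ring

/-- This treats together points outside the support and the time `t = 0`. -/
theorem dev_of_fixed {t : ℝ} {p : ℝ × E m} (hΞ : ∀ c, g.Ξ (t * c) p.2 = p.2)
    (hσ : g.σ t p.2 = 0) : g.dev t p = p := by
  have h1 := hΞ 1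
  rw [mul_one] at h1
  rw [dev, dev₀]
  simp only [hΞ, hσ, mul_zero, add_zero]
  rw [g.deck_zpow_of_fixed h1 hσ]
  simp

theorem dev_far (t : ℝ) {p : ℝ × E m} (hp : g.r < ‖p.2‖) : g.dev t p = p :=
  g.dev_of_fixed (fun _ => g.Ξ_far _ hp) (g.σ_far t _ hp)

theorem dev_zero (p : ℝ × E m) : g.dev 0 p = p :=
  g.dev_of_fixed (fun c => by rw [zero_mul, g.Ξ_zero]) (g.σ_zero _)

theorem Φ_mem (t : ℝ) {z : E m} (hz : z ∈ B m) : g.Φ t z ∈ B m := by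
  by_contra h
  have h1 := g.Φ_far t _ (lt_norm_of_notMem g.r_lt_one h)
  have h2 := congrArg (g.Ξ t) h1
  rw [g.Ξ_Φ, g.Ξ_Φ] at h2
  rw [h2] at h
  exact h hz

theorem Ξ_mem (t : ℝ) {z : E m} (hz : z ∈ B m) : g.Ξ t z ∈ B m := by
  by_contra h
  have h1 := g.Φ_far t _ (lt_norm_of_notMem g.r_lt_one h)
  rw [g.Φ_Ξ] at h1
  rw [← h1] at h
  exact h hz

theorem Ξ_mem_iff (t : ℝ) {z : E m} : g.Ξ t z ∈ B m ↔ z ∈ B m :=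
  ⟨fun h => by simpa [g.Φ_Ξ] using g.Φ_mem t h, g.Ξ_mem t⟩

theorem Φ_mem_iff (t : ℝ) {z : E m} : g.Φ t z ∈ B m ↔ z ∈ B m :=
  ⟨fun h => by simpa [g.Ξ_Φ] using g.Ξ_mem t h, g.Φ_mem t⟩

theorem deck_zpow_mem_iff (t : ℝ) (n : ℤ) (p : ℝ × E m) :
    ((g.deck t ^ n) p).2 ∈ B m ↔ p.2 ∈ B m := by
  induction n using Int.induction_on generalizing p with
  | zero => simp
  | succ k ih =>
    rw [zpow_add_one, Equiv.Perm.mul_apply, ih]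
    exact g.Ξ_mem_iff t
  | pred k ih =>
    rw [zpow_sub_one, Equiv.Perm.mul_apply, ih]
    exact g.Φ_mem_iff t

theorem dev_mem_iff (t : ℝ) (p : ℝ × E m) : (g.dev t p).2 ∈ B m ↔ p.2 ∈ B m := by
  rw [dev, deck_zpow_mem_iff]
  exact g.Ξ_mem_iff _

/-! #### Bijectivity -/

/-- From `σ ≥ δ - L` and `a' ≥ 0` one gets `a' σ ≥ -a' (L - δ) > -1`. This is where positivity of
the return times makes `dev₀` a diffeomorphism. -/
theorem one_add_deriv_pos (t s : ℝ) (w : E m) : 0 < 1 + deriv g.a s * g.σ t w := by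
  have h1 := g.δ_le t w
  have h2 := g.deriv_a_lt s
  have h3 := mul_le_mul_of_nonneg_left (show g.δ - L ≤ g.σ t w by linarith) (g.deriv_a_nonneg s)
  nlinarith

theorem hasDerivAt_height (t : ℝ) (w : E m) (s : ℝ) :
    HasDerivAt (fun s => s + g.a s * g.σ t w) (1 + deriv g.a s * g.σ t w) s :=
  (hasDerivAt_id s).add
    (((g.contDiff_a.differentiable (by simp)) s).hasDerivAt.mul_const (g.σ t w))

theorem strictMono_height (t : ℝ) (w : E m) : StrictMono fun s => s + g.a s * g.σ t w :=
  strictMono_of_deriv_pos fun s => by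
    rw [(g.hasDerivAt_height t w s).deriv]
    exact g.one_add_deriv_pos t s w

theorem height_zero (t : ℝ) (w : E m) : 0 + g.a 0 * g.σ t w = 0 := by
  simp [g.a_left 0 g.ε_pos.le]

theorem height_L (t : ℝ) (w : E m) : L + g.a L * g.σ t w = L + g.σ t w := by
  simp [g.a_right L (by linarith [g.ε_pos])]

theorem dev₀_injective (t : ℝ) : Function.Injective (g.dev₀ t) := by
  intro p q h
  simp only [dev₀, Prod.mk.injEq] at h
  obtain ⟨h1, h2⟩ := h
  rw [h2] at h1
  have h3 : p.1 = q.1 := (g.strictMono_height t _).injective h1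
  rw [h3] at h2
  refine Prod.ext h3 ?_
  have := congrArg (g.Φ (t * g.a q.1)) h2
  rwa [g.Φ_Ξ, g.Φ_Ξ] at this

theorem exists_dev₀_eq (t : ℝ) {q : ℝ × E m} (h0 : 0 ≤ q.1) (h1 : q.1 ≤ L + g.σ t q.2) :
    ∃ p, p.1 ∈ Icc 0 L ∧ g.dev₀ t p = q := by
  have hc : Continuous fun s => s + g.a s * g.σ t q.2 :=
    continuous_id.add (g.contDiff_a.continuous.mul continuous_const)
  obtain ⟨s, hs, hsq⟩ := intermediate_value_Icc g.L_pos.le hc.continuousOn (show q.1 ∈ _ by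
    rw [g.height_zero, g.height_L]
    exact ⟨h0, h1⟩)
  refine ⟨(s, g.Φ (t * g.a s) q.2), hs, ?_⟩
  simp only at hsq
  simp [dev₀, g.Ξ_Φ, hsq]

/-- The increasing height function fixes 0 and sends `L` to `L + σ_t(w)`. This and the next three
lemmas identify the image of the slab over `[0, L)` with the fundamental domain `0 ≤ s < L + σ_t(w)`
of `deck`. -/
theorem dev₀_nonneg_iff (t : ℝ) (p : ℝ × E m) : 0 ≤ (g.dev₀ t p).1 ↔ 0 ≤ p.1 := by
  have h := (g.strictMono_height t (g.Ξ (t * g.a p.1) p.2)).le_iff_le (a := 0) (b := p.1)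
  simp only [g.height_zero] at h
  exact h

theorem dev₀_pos_iff (t : ℝ) (p : ℝ × E m) : 0 < (g.dev₀ t p).1 ↔ 0 < p.1 := by
  have h := (g.strictMono_height t (g.Ξ (t * g.a p.1) p.2)).lt_iff_lt (a := 0) (b := p.1)
  simp only [g.height_zero] at h
  exact h

theorem dev₀_lt_iff (t : ℝ) (p : ℝ × E m) :
    (g.dev₀ t p).1 < L + g.σ t (g.dev₀ t p).2 ↔ p.1 < L := by
  have h := (g.strictMono_height t (g.Ξ (t * g.a p.1) p.2)).lt_iff_lt (a := p.1) (b := L)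
  simp only [g.height_L] at h
  exact h

theorem dev₀_le_iff (t : ℝ) (p : ℝ × E m) :
    (g.dev₀ t p).1 ≤ L + g.σ t (g.dev₀ t p).2 ↔ p.1 ≤ L := by
  have h := (g.strictMono_height t (g.Ξ (t * g.a p.1) p.2)).le_iff_le (a := p.1) (b := L)
  simp only [g.height_L] at h
  exact h

/-- The uniform gain `δ` makes deck orbits increasing in height and unbounded in both directions. -/
theorem deck_zpow_succ_fst (t : ℝ) (n : ℤ) (q : ℝ × E m) :
    ((g.deck t ^ n) q).1 + g.δ ≤ ((g.deck t ^ (n + 1)) q).1 := by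
  rw [add_comm n, zpow_one_add, Equiv.Perm.mul_apply, deck_apply]
  have := g.δ_le t (g.Ξ t ((g.deck t ^ n) q).2)
  simp only
  linarith

theorem strictMono_deck_zpow (t : ℝ) (q : ℝ × E m) :
    StrictMono fun n : ℤ => ((g.deck t ^ n) q).1 :=
  strictMono_int_of_lt_succ fun n => by
    have := g.deck_zpow_succ_fst t n q
    linarith [g.δ_pos]

theorem le_deck_zpow_fst (t : ℝ) (n : ℕ) (q : ℝ × E m) :
    q.1 + n * g.δ ≤ ((g.deck t ^ (n : ℤ)) q).1 := by
  induction n with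
  | zero => simp
  | succ n ih =>
    have := g.deck_zpow_succ_fst t n q
    push_cast at *
    linarith

theorem deck_zpow_neg_fst_le (t : ℝ) (n : ℕ) (q : ℝ × E m) :
    ((g.deck t ^ (-(n : ℤ))) q).1 ≤ q.1 - n * g.δ := by
  have h := g.le_deck_zpow_fst t n ((g.deck t ^ (-(n : ℤ))) q)
  rw [← Equiv.Perm.mul_apply, ← zpow_add, add_neg_cancel, zpow_zero, Equiv.Perm.one_apply] at h
  linarith

theorem exists_deck_zpow_pos (t : ℝ) (q : ℝ × E m) : ∃ n : ℤ, 0 < ((g.deck t ^ n) q).1 := by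
  obtain ⟨n, hn⟩ := exists_nat_gt (-q.1 / g.δ)
  rw [div_lt_iff₀ g.δ_pos] at hn
  exact ⟨n, by linarith [g.le_deck_zpow_fst t n q]⟩

theorem exists_deck_zpow_neg (t : ℝ) (q : ℝ × E m) : ∃ n : ℤ, ((g.deck t ^ n) q).1 < 0 := by
  obtain ⟨n, hn⟩ := exists_nat_gt (q.1 / g.δ)
  rw [div_lt_iff₀ g.δ_pos] at hn
  exact ⟨-n, by linarith [g.deck_zpow_neg_fst_le t n q]⟩

/-- Every orbit of the deck group meets the fundamental domain. -/
theorem exists_deck_zpow_mem (t : ℝ) (q : ℝ × E m) : ∃ n : ℤ, 0 ≤ ((g.deck t ^ n) q).1 ∧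
    ((g.deck t ^ n) q).1 < L + g.σ t ((g.deck t ^ n) q).2 := by
  obtain ⟨N, hN⟩ := g.exists_deck_zpow_neg t q
  obtain ⟨M, hM⟩ := g.exists_deck_zpow_pos t q
  -- Take the first translate of nonnegative height. Were it at or above the upper hypersurface, one
  -- inverse deck step would still have nonnegative height, against minimality.
  obtain ⟨n, hn, hmin⟩ := Int.exists_least_of_bdd (P := fun n => 0 ≤ ((g.deck t ^ n) q).1)
    ⟨N, fun n hn => (g.strictMono_deck_zpow t q).le_iff_le.1 (hN.le.trans hn)⟩ ⟨M, hM.le⟩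
  refine ⟨n, hn, ?_⟩
  by_contra! h
  have h1 : 0 ≤ ((g.deck t ^ (n - 1)) q).1 := by
    rw [sub_eq_add_neg, add_comm, zpow_add, Equiv.Perm.mul_apply, zpow_neg_one, deck_inv_apply]
    simp only
    linarith
  have := hmin _ h1
  omega

/-- The translates of the fundamental domain are disjoint. -/
theorem deck_zpow_eq_zero (t : ℝ) {n : ℤ} {q : ℝ × E m} (h0 : 0 ≤ q.1)
    (h1 : q.1 < L + g.σ t q.2) (h2 : 0 ≤ ((g.deck t ^ n) q).1)
    (h3 : ((g.deck t ^ n) q).1 < L + g.σ t ((g.deck t ^ n) q).2) : n = 0 := by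
  have key : ∀ k : ℤ, ((g.deck t ^ (k - 1)) q).1 =
      ((g.deck t ^ k) q).1 - L - g.σ t ((g.deck t ^ k) q).2 := fun k => by
    rw [sub_eq_add_neg k, add_comm k, zpow_add, Equiv.Perm.mul_apply, zpow_neg_one, deck_inv_apply]
  have hm := g.strictMono_deck_zpow t q
  -- One inverse deck step takes a point of the domain to negative height. Applied to `deck ^ n q`
  -- this gives `n - 1 < 0`; applied to `q` it gives `-1 < n`.
  have ha : ((g.deck t ^ (n - 1)) q).1 < ((g.deck t ^ (0 : ℤ)) q).1 := by
    rw [key]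
    simp only [zpow_zero, Equiv.Perm.one_apply]
    linarith
  have hb : ((g.deck t ^ ((0 : ℤ) - 1)) q).1 < ((g.deck t ^ n) q).1 := by
    rw [key]
    simp only [zpow_zero, Equiv.Perm.one_apply]
    linarith
  have ha' := hm.lt_iff_lt.1 ha
  have hb' := hm.lt_iff_lt.1 hb
  omega

theorem dev_injective (t : ℝ) : Function.Injective (g.dev t) := by
  have hL := g.L_pos
  have hfl : ∀ p : ℝ × E m, 0 ≤ p.1 - ⌊p.1 / L⌋ * L ∧ p.1 - ⌊p.1 / L⌋ * L < L := fun p => by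
    have hj1 : (⌊p.1 / L⌋ : ℝ) * L ≤ p.1 := (le_div_iff₀ hL).1 (Int.floor_le _)
    have hj2 : p.1 < (⌊p.1 / L⌋ + 1) * L := (div_lt_iff₀ hL).1 (Int.lt_floor_add_one _)
    constructor <;> linarith
  intro p q h
  rw [dev, dev] at h
  have h' : (g.deck t ^ (-⌊q.1 / L⌋ + ⌊p.1 / L⌋)) (g.dev₀ t (p.1 - ⌊p.1 / L⌋ * L, p.2)) =
      g.dev₀ t (q.1 - ⌊q.1 / L⌋ * L, q.2) := by
    rw [zpow_add, Equiv.Perm.mul_apply, h, ← Equiv.Perm.mul_apply, ← zpow_add]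
    simp
  have hn := g.deck_zpow_eq_zero t ((g.dev₀_nonneg_iff t _).2 (hfl p).1)
    ((g.dev₀_lt_iff t _).2 (hfl p).2) (n := -⌊q.1 / L⌋ + ⌊p.1 / L⌋)
    (by rw [h']; exact (g.dev₀_nonneg_iff t _).2 (hfl q).1)
    (by rw [h']; exact (g.dev₀_lt_iff t _).2 (hfl q).2)
  have hpq : ⌊p.1 / L⌋ = ⌊q.1 / L⌋ := by omega
  rw [hn, zpow_zero, Equiv.Perm.one_apply, hpq] at h'
  have h2 := g.dev₀_injective t h'
  simp only [Prod.mk.injEq, sub_left_inj] at h2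
  exact Prod.ext h2.1 h2.2

theorem dev_surjective (t : ℝ) : Function.Surjective (g.dev t) := by
  intro q
  have hL := g.L_pos
  have hε := g.ε_pos
  obtain ⟨n, h0, h1⟩ := g.exists_deck_zpow_mem t q
  obtain ⟨p, hp, hpq⟩ := g.exists_dev₀_eq t h0 h1.le
  refine ⟨(p.1 + (-n : ℤ) * L, p.2), ?_⟩
  -- Only `p.1 ≤ L` is known here; at `p.1 = L` the floor would be one larger, and the `ε` margin of
  -- `dev_eq` absorbs this.
  rw [g.dev_eq t (-n) (by simp only; linarith [hp.1]) (by simp only; linarith [hp.2])]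
  simp only [add_sub_cancel_right]
  rw [hpq, ← Equiv.Perm.mul_apply, ← zpow_add]
  simp

/-- The developing map as a bijection. -/
def devEquiv (t : ℝ) : (ℝ × E m) ≃ (ℝ × E m) :=
  Equiv.ofBijective (g.dev t) ⟨g.dev_injective t, g.dev_surjective t⟩

theorem devEquiv_apply (t : ℝ) (p : ℝ × E m) : g.devEquiv t p = g.dev t p := rfl

theorem dev_devEquiv_symm (t : ℝ) (q : ℝ × E m) : g.dev t ((g.devEquiv t).symm q) = q :=
  (g.devEquiv t).apply_symm_apply q

/-! #### The derivative -/

/-- Factor `dev₀ = P ∘ Q`, where `Q` is a fibrewise diffeomorphism and `P` moves only the height.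
The derivative of `P` is triangular with the positive entry `1 + a' σ`. -/
theorem fderiv_dev₀_injective (t : ℝ) (p : ℝ × E m) :
    Function.Injective (fderiv ℝ (g.dev₀ t) p) := by
  let Q : ℝ × E m → ℝ × E m := fun p => (p.1, g.Ξ (t * g.a p.1) p.2)
  let Q' : ℝ × E m → ℝ × E m := fun p => (p.1, g.Φ (t * g.a p.1) p.2)
  let P : ℝ × E m → ℝ × E m := fun p => (p.1 + g.a p.1 * g.σ t p.2, p.2)
  have ha : ContDiff ℝ ∞ (fun p : ℝ × E m => (t * g.a p.1, p.2)) :=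
    (contDiff_const.mul (g.contDiff_a.comp contDiff_fst)).prodMk contDiff_snd
  have hQ : ContDiff ℝ ∞ Q := contDiff_fst.prodMk (g.contDiff_Ξ.comp ha)
  have hQ' : ContDiff ℝ ∞ Q' := contDiff_fst.prodMk (g.contDiff_Φ.comp ha)
  have hQi := fderiv_injective_of_leftInverse (f := Q) (g := Q') (x := p)
    (fun x => by simp [Q, Q', g.Φ_Ξ]) (hQ.differentiable (by simp) _)
    (hQ'.differentiable (by simp) _)
  have hσ : ContDiff ℝ ∞ (g.σ t) := g.contDiff_σ.comp (contDiff_const.prodMk contDiff_id)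
  have hPd : ∀ q : ℝ × E m, HasFDerivAt P
      ((ContinuousLinearMap.fst ℝ ℝ (E m) +
        (g.a q.1 • (fderiv ℝ (g.σ t) q.2).comp (ContinuousLinearMap.snd ℝ ℝ (E m)) +
          g.σ t q.2 • (deriv g.a q.1 • ContinuousLinearMap.fst ℝ ℝ (E m)))).prod
        (ContinuousLinearMap.snd ℝ ℝ (E m))) q := fun q => by
    have h1 : HasFDerivAt (fun q : ℝ × E m => g.a q.1)
        (deriv g.a q.1 • ContinuousLinearMap.fst ℝ ℝ (E m)) q :=
      ((g.contDiff_a.differentiable (by simp)) q.1).hasDerivAt.comp_hasFDerivAt q hasFDerivAt_fst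
    have h2 : HasFDerivAt (fun q : ℝ × E m => g.σ t q.2)
        ((fderiv ℝ (g.σ t) q.2).comp (ContinuousLinearMap.snd ℝ ℝ (E m))) q :=
      ((hσ.differentiable (by simp)) q.2).hasFDerivAt.comp q hasFDerivAt_snd
    exact (hasFDerivAt_fst.add (h1.mul h2)).prodMk hasFDerivAt_snd
  have hPi : ∀ q, Function.Injective (fderiv ℝ P q) := fun q => by
    rw [injective_iff_map_eq_zero, (hPd q).fderiv]
    rintro ⟨x, v⟩ h
    simp only [ContinuousLinearMap.prod_apply, add_apply, ContinuousLinearMap.coe_fst',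
      ContinuousLinearMap.coe_snd', smul_apply, ContinuousLinearMap.comp_apply, smul_eq_mul,
      Prod.mk_eq_zero] at h
    obtain ⟨h1, rfl⟩ := h
    rw [map_zero] at h1
    have h3 : (1 + deriv g.a q.1 * g.σ t q.2) * x = 0 := by linarith
    rcases mul_eq_zero.1 h3 with h4 | h4
    · exact absurd h4 (g.one_add_deriv_pos t q.1 q.2).ne'
    · rw [h4]
      rfl
  have hcomp : HasFDerivAt (g.dev₀ t) ((fderiv ℝ P (Q p)).comp (fderiv ℝ Q p)) p :=
    ((hPd (Q p)).differentiableAt.hasFDerivAt).comp p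
      ((hQ.differentiable (by simp)) p).hasFDerivAt
  rw [hcomp.fderiv]
  exact (hPi _).comp hQi

theorem fderiv_deck_zpow_injective (t : ℝ) (k : ℤ) (p : ℝ × E m) :
    Function.Injective (fderiv ℝ (g.deck t ^ k) p) :=
  fderiv_injective_of_leftInverse (g := ⇑(g.deck t ^ (-k)))
    (fun x => by rw [← Equiv.Perm.mul_apply, ← zpow_add]; simp)
    ((g.contDiff_deck_zpow_apply t k).differentiable (by simp) _)
    ((g.contDiff_deck_zpow_apply t (-k)).differentiable (by simp) _)

theorem fderiv_dev_injective (t : ℝ) (p : ℝ × E m) :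
    Function.Injective (fderiv ℝ (g.dev t) p) := by
  obtain ⟨k, hk⟩ := g.dev_eventuallyEq (t, p)
  have h1 : g.dev t =ᶠ[𝓝 p] fun p => (g.deck t ^ k) (g.dev₀ t (p.1 - k * L, p.2)) :=
    (show Continuous (fun p : ℝ × E m => (t, p)) by fun_prop).continuousAt.eventually hk
  have h2 : HasFDerivAt (fun p : ℝ × E m => (p.1 - k * L, p.2))
      (ContinuousLinearMap.id ℝ (ℝ × E m)) p := by
    rw [← ContinuousLinearMap.fst_prod_snd]
    exact (hasFDerivAt_fst.sub_const (k * L)).prodMk hasFDerivAt_snd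
  have h3 : HasFDerivAt (fun p => (g.deck t ^ k) (g.dev₀ t (p.1 - k * L, p.2)))
      ((fderiv ℝ (g.deck t ^ k) (g.dev₀ t (p.1 - k * L, p.2))).comp
        ((fderiv ℝ (g.dev₀ t) (p.1 - k * L, p.2)).comp (ContinuousLinearMap.id ℝ _))) p :=
    (((g.contDiff_deck_zpow_apply t k).differentiable (by simp)) _).hasFDerivAt.comp p
      ((((g.contDiff_dev₀_apply t).differentiable (by simp)) _).hasFDerivAt.comp p h2)
  rw [h1.fderiv_eq, h3.fderiv]
  exact (g.fderiv_deck_zpow_injective t k _).comp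
    ((g.fderiv_dev₀_injective t _).comp Function.injective_id)

theorem fderiv_dev_surjective (t : ℝ) (p : ℝ × E m) :
    Function.Surjective (fderiv ℝ (g.dev t) p) :=
  LinearMap.injective_iff_surjective.1 (g.fderiv_dev_injective t p)

theorem det_fderiv_dev_ne_zero (t : ℝ) (p : ℝ × E m) : (fderiv ℝ (g.dev t) p).det ≠ 0 := by
  intro h
  have h1 : LinearMap.ker (fderiv ℝ (g.dev t) p).toLinearMap = ⊥ :=
    LinearMap.ker_eq_bot.2 (g.fderiv_dev_injective t p)
  exact (LinearMap.bot_lt_ker_of_det_eq_zero h).ne' h1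

theorem continuous_det_fderiv_dev (t : ℝ) :
    Continuous fun p => (fderiv ℝ (g.dev t) p).det :=
  ContinuousLinearMap.continuous_det.comp
    ((g.contDiff_dev_apply t).continuous_fderiv (by simp))

theorem fderiv_dev_of_abs_lt (t : ℝ) {p : ℝ × E m} (hp : |p.1| < g.ε) :
    fderiv ℝ (g.dev t) p = ContinuousLinearMap.id ℝ (ℝ × E m) := by
  have h : g.dev t =ᶠ[𝓝 p] id := by
    filter_upwards [(isOpen_lt continuous_fst.abs continuous_const).mem_nhds hp] with q hq
    exact g.dev_of_abs_lt t hq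
  rw [h.fderiv_eq, fderiv_id]

theorem fderiv_dev_far (t : ℝ) {p : ℝ × E m} (hp : g.r < ‖p.2‖) :
    fderiv ℝ (g.dev t) p = ContinuousLinearMap.id ℝ (ℝ × E m) := by
  have h : g.dev t =ᶠ[𝓝 p] id := by
    filter_upwards [(isOpen_lt continuous_const continuous_snd.norm).mem_nhds hp] with q hq
    exact g.dev_far t hq
  rw [h.fderiv_eq, fderiv_id]

/-- The determinant is continuous on a connected space, never zero, and equal to 1 at the origin.
Its sign determines the orientation in the contact volume. -/
theorem det_fderiv_dev_pos (t : ℝ) (p : ℝ × E m) : 0 < (fderiv ℝ (g.dev t) p).det := by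
  by_contra! h
  have h0 : (fderiv ℝ (g.dev t) (0, 0)).det = 1 := by
    rw [g.fderiv_dev_of_abs_lt t (by simpa using g.ε_pos)]
    exact LinearMap.det_id
  obtain ⟨q, hq⟩ := mem_range_of_exists_le_of_exists_ge (g.continuous_det_fderiv_dev t) ⟨p, h⟩
    ⟨(0, 0), by rw [h0]; exact zero_le_one⟩
  exact g.det_fderiv_dev_ne_zero t q hq

theorem contDiff_devEquiv_symm (t : ℝ) : ContDiff ℝ ∞ (g.devEquiv t).symm :=
  contDiff_inverse (g.contDiff_dev_apply t) (g.devEquiv t).symm_apply_apply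
    (g.dev_devEquiv_symm t) (g.fderiv_dev_injective t)

end MappingTorus

end ContactTorus

end

/-! ### The standard contact form on the cover, its pull-backs and their Reeb flows -/

noncomputable section

namespace ContactTorus

/-- The form `ds + λ` on `ℝ × ℝ^{2m}`. -/
def stdCover {m : ℕ} (q : ℝ × E m) : (ℝ × E m) →L[ℝ] ℝ :=
  ContinuousLinearMap.fst ℝ ℝ (E m) + (liouville q.2).comp (ContinuousLinearMap.snd ℝ ℝ (E m))

theorem stdCover_apply {m : ℕ} (q v : ℝ × E m) : stdCover q v = v.1 + liouville q.2 v.2 := rfl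

theorem contDiff_stdCover {m : ℕ} : ContDiff ℝ ∞ (stdCover (m := m)) := by
  obtain ⟨l, hl⟩ := exists_liouville_eq m
  have : stdCover (m := m) = fun q => ContinuousLinearMap.fst ℝ ℝ (E m) +
      (l q.2).comp (ContinuousLinearMap.snd ℝ ℝ (E m)) := by
    funext q
    rw [stdCover, hl]
  rw [this]
  exact contDiff_const.add ((l.contDiff.comp contDiff_snd).clm_comp contDiff_const)

theorem dForm_stdCover {m : ℕ} (q u v : ℝ × E m) :
    dForm stdCover q u v = stdSymplectic u.2 v.2 := by
  obtain ⟨l, hl⟩ := exists_liouville_eq m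
  rw [dForm_eq (contDiff_stdCover.differentiable (by simp) q)]
  have h : ∀ x y : ℝ × E m, fderiv ℝ stdCover q x y = liouville x.2 y.2 := fun x y => by
    have h1 : HasFDerivAt (fun q : ℝ × E m => stdCover q y)
        ((fderiv ℝ stdCover q).flip y) q := by
      have := (contDiff_stdCover.differentiable (by simp) q).hasFDerivAt.clm_apply
        (hasFDerivAt_const y q)
      simpa using this
    have h2 : HasFDerivAt (fun q : ℝ × E m => y.1 + l.flip y.2 q.2)
        ((l.flip y.2).comp (ContinuousLinearMap.snd ℝ ℝ (E m))) q :=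
      ((l.flip y.2).hasFDerivAt.comp q hasFDerivAt_snd).const_add y.1
    have h3 : (fun q : ℝ × E m => stdCover q y) = fun q => y.1 + l.flip y.2 q.2 := by
      funext q
      rw [stdCover_apply, hl]
      rfl
    rw [h3] at h1
    have h4 := congrArg (fun A : (ℝ × E m) →L[ℝ] ℝ => A x) (h1.unique h2)
    simpa [← hl] using h4
  rw [h, h, liouville_sub_swap]

namespace MappingTorus

variable {m : ℕ} {L : ℝ} (g : MappingTorus m L)

/-! ### The contact forms -/

/-- The pull-back of `ds + λ` under the developing map. -/
def coverForm (t : ℝ) (p : ℝ × E m) : (ℝ × E m) →L[ℝ] ℝ :=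
  (stdCover (g.dev t p)).comp (fderiv ℝ (g.dev t) p)

/-- The induced form on `ℝ/Lℤ × ℝ^{2m}`. -/
def form (t : ℝ) : OneForm L m := fun x => g.coverForm t (Quotient.out x.1, x.2)

/-- Here `d(σ ∘ Ξ) = Ξ^*(Φ^*λ - λ) = λ - Ξ^*λ`, because `Φ ∘ Ξ = id`; this cancels the term `Ξ^*λ`
coming from `λ`. -/
theorem deck_pullback (t : ℝ) (q : ℝ × E m) :
    (stdCover (g.deck t q)).comp (fderiv ℝ (g.deck t) q) = stdCover q := by
  have hΞ : ContDiff ℝ ∞ (g.Ξ t) := g.contDiff_Ξ.comp (contDiff_const.prodMk contDiff_id)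
  have hΦ : ContDiff ℝ ∞ (g.Φ t) := g.contDiff_Φ.comp (contDiff_const.prodMk contDiff_id)
  have hσ : ContDiff ℝ ∞ (g.σ t) := g.contDiff_σ.comp (contDiff_const.prodMk contDiff_id)
  have h1 : HasFDerivAt (fun q : ℝ × E m => g.Ξ t q.2)
      ((fderiv ℝ (g.Ξ t) q.2).comp (ContinuousLinearMap.snd ℝ ℝ (E m))) q :=
    (hΞ.differentiable (by simp) q.2).hasFDerivAt.comp q hasFDerivAt_snd
  have h2 : HasFDerivAt (fun q : ℝ × E m => g.σ t (g.Ξ t q.2))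
      ((fderiv ℝ (g.σ t) (g.Ξ t q.2)).comp
        ((fderiv ℝ (g.Ξ t) q.2).comp (ContinuousLinearMap.snd ℝ ℝ (E m)))) q :=
    (hσ.differentiable (by simp) _).hasFDerivAt.comp q h1
  have h3 : HasFDerivAt (g.deck t) _ q :=
    ((hasFDerivAt_fst.add_const L).add h2).prodMk h1
  have h4 : ∀ v, fderiv ℝ (g.Φ t) (g.Ξ t q.2) (fderiv ℝ (g.Ξ t) q.2 v) = v := fun v => by
    have h5 : HasFDerivAt (fun z => g.Φ t (g.Ξ t z))
        ((fderiv ℝ (g.Φ t) (g.Ξ t q.2)).comp (fderiv ℝ (g.Ξ t) q.2)) q.2 :=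
      (hΦ.differentiable (by simp) _).hasFDerivAt.comp q.2
        (hΞ.differentiable (by simp) q.2).hasFDerivAt
    simp only [g.Φ_Ξ] at h5
    exact congrArg (fun A : E m →L[ℝ] E m => A v) (h5.unique (hasFDerivAt_id q.2))
  rw [h3.fderiv]
  refine ContinuousLinearMap.ext fun v => ?_
  simp only [ContinuousLinearMap.comp_apply, stdCover_apply, deck_apply,
    ContinuousLinearMap.prod_apply, add_apply, ContinuousLinearMap.coe_fst',
    ContinuousLinearMap.coe_snd', g.fderiv_σ, sub_apply, h4, g.Φ_Ξ]
  ring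

theorem coverForm_add (t : ℝ) (p : ℝ × E m) :
    g.coverForm t (p.1 + L, p.2) = g.coverForm t p := by
  have hshift : ∀ p : ℝ × E m, p + (L, 0) = (p.1 + L, p.2) := fun p => by
    ext1 <;> simp
  have h1 : (fun p => g.dev t (p + (L, 0))) = fun p => g.deck t (g.dev t p) := by
    funext p
    rw [hshift, g.dev_add]
  have h2 : fderiv ℝ (g.dev t) (p + (L, 0)) =
      (fderiv ℝ (g.deck t) (g.dev t p)).comp (fderiv ℝ (g.dev t) p) := by
    rw [← fderiv_comp_add_right, h1]
    have hd : ContDiff ℝ ∞ (g.deck t) := by simpa using g.contDiff_deck_zpow_apply t 1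
    exact ((hd.differentiable (by simp) _).hasFDerivAt.comp p
      (g.differentiable_dev t p).hasFDerivAt).fderiv
  rw [hshift] at h2
  rw [coverForm, h2, g.dev_add, ← ContinuousLinearMap.comp_assoc, g.deck_pullback, coverForm]

theorem coverForm_add_int (t : ℝ) (p : ℝ × E m) (n : ℤ) :
    g.coverForm t (p.1 + n * L, p.2) = g.coverForm t p := by
  have h : Function.Periodic (fun s => g.coverForm t (s, p.2)) L := fun s =>
    g.coverForm_add t (s, p.2)
  exact h.int_mul n p.1

theorem exists_int_of_coe_eq {s s' : ℝ} (h : (s : AddCircle L) = s') : ∃ n : ℤ, s' = s + n * L := by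
  have h1 : ((s' - s : ℝ) : AddCircle L) = 0 := by
    rw [AddCircle.coe_sub, h, sub_self]
  obtain ⟨n, hn⟩ := (AddCircle.coe_eq_zero_iff L).1 h1
  refine ⟨n, ?_⟩
  rw [zsmul_eq_mul] at hn
  linarith

theorem coe_out (x : AddCircle L) : ((Quotient.out x : ℝ) : AddCircle L) = x :=
  Quotient.out_eq x

/-- Periodicity makes the representative chosen in `form` immaterial. -/
theorem lift_form (t : ℝ) : (g.form t).lift = g.coverForm t := by
  funext p
  obtain ⟨n, hn⟩ := exists_int_of_coe_eq (coe_out (p.1 : AddCircle L)).symm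
  change g.coverForm t (Quotient.out (p.1 : AddCircle L), p.2) = _
  rw [hn, g.coverForm_add_int]

theorem coverForm_apply (t : ℝ) (p v : ℝ × E m) : g.coverForm t p v =
    (fderiv ℝ (g.dev t) p v).1 + liouville (g.dev t p).2 (fderiv ℝ (g.dev t) p v).2 := rfl

theorem contDiff_coverForm :
    ContDiff ℝ ∞ (fun q : ℝ × (ℝ × E m) => g.coverForm q.1 q.2) :=
  (contDiff_stdCover.comp g.contDiff_dev).clm_comp (contDiff_fderiv_snd (f := g.dev) g.contDiff_dev)

theorem dForm_coverForm (t : ℝ) (p u v : ℝ × E m) : dForm (g.coverForm t) p u v =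
    stdSymplectic (fderiv ℝ (g.dev t) p u).2 (fderiv ℝ (g.dev t) p v).2 := by
  rw [← dForm_stdCover (g.dev t p)]
  exact dForm_pullback (contDiff_stdCover.differentiable (by simp) _)
    (g.contDiff_dev_apply t).contDiffAt u v

theorem volCoeff_form (t : ℝ) (p : ℝ × E m) :
    volCoeff (g.form t) p = (fderiv ℝ (g.dev t) p).det * m.factorial := by
  rw [← wedgeOnePow_stdForm (liouville (g.dev t p).2), volCoeff, g.lift_form]
  congr 1
  funext u v
  exact g.dForm_coverForm t p u v

theorem isContactForm_form (t : ℝ) : IsContactForm (g.form t) where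
  contDiffOn := by
    rw [g.lift_form]
    exact (g.contDiff_coverForm.comp (contDiff_const.prodMk contDiff_id)).contDiffOn
  nondegenerate p _ := by
    rw [g.volCoeff_form]
    exact mul_ne_zero (g.det_fderiv_dev_ne_zero t p) (by exact_mod_cast m.factorial_ne_zero)

theorem coverForm_of_fderiv {t : ℝ} {p : ℝ × E m} (h1 : g.dev t p = p)
    (h2 : fderiv ℝ (g.dev t) p = ContinuousLinearMap.id ℝ (ℝ × E m)) :
    g.coverForm t p = stdCover p := by
  rw [coverForm, h1, h2, ContinuousLinearMap.comp_id]

theorem form_far (t : ℝ) {x : AddCircle L × E m} (hx : g.r < ‖x.2‖) :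
    g.form t x = stdForm L m x :=
  g.coverForm_of_fderiv (g.dev_far t hx) (g.fderiv_dev_far t hx)

theorem form_zero (x : AddCircle L × E m) : g.form 0 x = stdForm L m x := by
  have h : g.dev 0 = id := funext g.dev_zero
  exact g.coverForm_of_fderiv (g.dev_zero _) (by rw [h, fderiv_id])

/-! ### The Reeb flow -/

/-- The Reeb field of `ds + λ` is `∂_s`, and Reeb fields are natural under local diffeomorphisms.
Surjectivity of the derivative supplies enough test vectors to use nondegeneracy of `ω`. -/
theorem isReebVector_iff (t : ℝ) (p w : ℝ × E m) :
    IsReebVector (g.form t) p w ↔ fderiv ℝ (g.dev t) p w = (1, 0) := by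
  rw [IsReebVector, g.lift_form]
  simp only [g.dForm_coverForm, coverForm_apply]
  constructor
  · rintro ⟨h1, h2⟩
    have h3 : (fderiv ℝ (g.dev t) p w).2 = 0 := eq_zero_of_stdSymplectic fun v => by
      obtain ⟨u, hu⟩ := g.fderiv_dev_surjective t p (0, v)
      have := h2 u
      rwa [hu] at this
    rw [h3, map_zero, add_zero] at h1
    exact Prod.ext h1 h3
  · intro h
    simp [h, stdSymplectic]

theorem dev_add_int (t : ℝ) (p : ℝ × E m) (n : ℤ) :
    g.dev t (p.1 + n * L, p.2) = (g.deck t ^ n) (g.dev t p) := by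
  induction n using Int.induction_on with
  | zero => simp
  | succ k ih =>
    have h := g.dev_add t (p.1 + (k : ℤ) * L, p.2)
    rw [ih, ← Equiv.Perm.mul_apply, ← zpow_one_add] at h
    rw [add_comm (k : ℤ) 1, ← h]
    push_cast
    congr 2
    ring
  | pred k ih =>
    have h := g.dev_add t (p.1 + (-(k : ℤ) - 1 : ℤ) * L, p.2)
    have h2 : (p.1 + ((-(k : ℤ) - 1 : ℤ) : ℝ) * L + L, p.2) = (p.1 + (-(k : ℤ) : ℤ) * L, p.2) := by
      push_cast
      congr 1
      ring
    simp only [h2, ih] at h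
    have h3 : g.deck t ^ (-(k : ℤ) - 1) = (g.deck t)⁻¹ * g.deck t ^ (-(k : ℤ)) := by
      rw [sub_eq_add_neg, add_comm, zpow_add, zpow_neg_one]
    rw [h3, Equiv.Perm.mul_apply, h]
    exact ((g.deck t).symm_apply_apply _).symm

theorem proj_add_int (p : ℝ × E m) (n : ℤ) : proj L (p.1 + n * L, p.2) = proj L p := by
  refine Prod.ext ?_ rfl
  simp only [proj, AddCircle.coe_add]
  have : ((n * L : ℝ) : AddCircle L) = 0 :=
    (AddCircle.coe_eq_zero_iff L).2 ⟨n, by rw [zsmul_eq_mul]⟩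
  rw [this, add_zero]

theorem proj_devEquiv_symm_deck (t : ℝ) (n : ℤ) (q : ℝ × E m) :
    proj L ((g.devEquiv t).symm ((g.deck t ^ n) q)) = proj L ((g.devEquiv t).symm q) := by
  have h := g.dev_add_int t ((g.devEquiv t).symm q) n
  rw [g.dev_devEquiv_symm] at h
  rw [← h, ← devEquiv_apply, Equiv.symm_apply_apply, proj_add_int]

/-- The orbit of the Reeb flow through the point with developing image `q`. -/
def orbit (t : ℝ) (q : ℝ × E m) (s : ℝ) : AddCircle L × E m :=
  proj L ((g.devEquiv t).symm (q + (s, 0)))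

theorem orbit_deck (t : ℝ) (n : ℤ) (q : ℝ × E m) :
    g.orbit t ((g.deck t ^ n) q) = g.orbit t q := by
  funext s
  rw [orbit, ← g.deck_zpow_add, g.proj_devEquiv_symm_deck, orbit]

theorem isReebOrbit_orbit (t : ℝ) {q : ℝ × E m} (hq : q.2 ∈ B m) :
    IsReebOrbit (g.form t) (g.orbit t q) := by
  refine ⟨fun s => (g.devEquiv t).symm (q + (s, 0)), fun s => ⟨rfl, ?_, ?_⟩⟩
  · rw [← g.dev_mem_iff t, g.dev_devEquiv_symm]
    simpa using hq
  · have h1 : HasDerivAt (fun s : ℝ => q + (s, (0 : E m))) (1, 0) s :=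
      ((hasDerivAt_id s).prodMk (hasDerivAt_const s (0 : E m))).const_add q
    have h2 := ((g.contDiff_devEquiv_symm t).differentiable (by simp)
      (q + (s, 0))).hasFDerivAt.comp_hasDerivAt (f := fun s : ℝ => q + (s, (0 : E m))) s h1
    refine ⟨_, ?_, h2⟩
    rw [isReebVector_iff]
    have h3 := (g.differentiable_dev t _).hasFDerivAt.comp_hasDerivAt s h2
    have h4 : g.dev t ∘ ((g.devEquiv t).symm ∘ fun s : ℝ => q + (s, (0 : E m))) =
        fun s : ℝ => q + (s, (0 : E m)) := by
      funext s
      exact g.dev_devEquiv_symm t _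
    rw [h4] at h3
    exact h3.unique h1

/-- In developed coordinates the velocity is the constant `(1, 0)`, so every orbit is an explicit
line. Uniqueness of orbits follows without any theorem on differential equations. -/
theorem exists_eq_orbit {t : ℝ} {γ : ℝ → AddCircle L × E m}
    (h : IsReebOrbit (g.form t) γ) : ∃ q : ℝ × E m, q.2 ∈ B m ∧ γ = g.orbit t q := by
  obtain ⟨c, hc⟩ := h
  have hd : ∀ s, HasDerivAt (fun s => g.dev t (c s) - (s, (0 : E m))) 0 s := fun s => by
    obtain ⟨-, -, w, hw, hcw⟩ := hc s
    rw [isReebVector_iff] at hw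
    have h1 : HasDerivAt (fun s => g.dev t (c s)) (fderiv ℝ (g.dev t) (c s) w) s :=
      (g.differentiable_dev t _).hasFDerivAt.comp_hasDerivAt s hcw
    have h2 := h1.sub ((hasDerivAt_id s).prodMk (hasDerivAt_const s (0 : E m)))
    rw [hw, sub_self] at h2
    exact h2
  have hconst : ∀ s, g.dev t (c s) - (s, (0 : E m)) = g.dev t (c 0) := fun s => by
    have := is_const_of_deriv_eq_zero (fun s => (hd s).differentiableAt)
      (fun s => (hd s).deriv) s 0
    rwa [Prod.mk_zero_zero, sub_zero] at this
  refine ⟨g.dev t (c 0), (g.dev_mem_iff t _).2 (hc 0).2.1, ?_⟩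
  funext s
  rw [(hc s).1, orbit, ← hconst s, sub_add_cancel, ← devEquiv_apply, Equiv.symm_apply_apply]

theorem orbit_zero (t : ℝ) (p : ℝ × E m) : g.orbit t (g.dev t p) 0 = proj L p := by
  rw [orbit, Prod.mk_zero_zero, add_zero, ← devEquiv_apply, Equiv.symm_apply_apply]

theorem orbit_eq_of_zero {t : ℝ} {q p : ℝ × E m} (h : g.orbit t q 0 = proj L p) :
    g.orbit t q = g.orbit t (g.dev t p) := by
  obtain ⟨p', rfl⟩ := g.dev_surjective t q
  rw [g.orbit_zero] at h
  obtain ⟨n, hn⟩ := exists_int_of_coe_eq (congrArg Prod.fst h).symm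
  have h2 : p'.2 = p.2 := congrArg (fun x : AddCircle L × E m => x.2) h
  have hp' : p' = (p.1 + n * L, p.2) := Prod.ext hn h2
  rw [hp', g.dev_add_int, g.orbit_deck]

theorem existsUnique_isReebOrbit (t : ℝ) {x : AddCircle L × E m} (hx : x.2 ∈ B m) :
    ∃! γ, IsReebOrbit (g.form t) γ ∧ γ 0 = x := by
  have hp : proj L ((Quotient.out x.1 : ℝ), x.2) = x := Prod.ext (coe_out x.1) rfl
  refine ⟨g.orbit t (g.dev t (Quotient.out x.1, x.2)), ⟨g.isReebOrbit_orbit t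
    ((g.dev_mem_iff t _).2 hx), (g.orbit_zero t _).trans hp⟩, ?_⟩
  rintro γ ⟨hγ, h0⟩
  obtain ⟨q, -, rfl⟩ := g.exists_eq_orbit hγ
  exact g.orbit_eq_of_zero (h0.trans hp.symm)

theorem dev_zero_fst (t : ℝ) (z : E m) : g.dev t (0, z) = (0, z) :=
  g.dev_of_abs_lt t (by simpa using g.ε_pos)

theorem proj_devEquiv_symm_zero (t : ℝ) (z : E m) :
    proj L ((g.devEquiv t).symm (0, z)) = (0, z) := by
  conv_lhs => rw [← g.dev_zero_fst t z, ← devEquiv_apply, Equiv.symm_apply_apply]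
  simp [proj]

/-- Since `dev` fixes `{0} × ℝ^{2m}` pointwise, the lifts of the hypersurface develop to its deck
translates. -/
theorem orbit_fst_eq_zero_iff (t : ℝ) (q : ℝ × E m) (s : ℝ) :
    (g.orbit t q s).1 = 0 ↔ ∃ n : ℤ, ((g.deck t ^ n) (q + (s, 0))).1 = 0 := by
  rw [orbit]
  set q' := q + (s, (0 : E m))
  constructor
  · intro h
    obtain ⟨p, hp⟩ := g.dev_surjective t q'
    rw [← hp, ← devEquiv_apply, Equiv.symm_apply_apply] at h
    obtain ⟨n, hn⟩ := exists_int_of_coe_eq (s := 0) (s' := p.1) (L := L)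
      (by simpa [proj] using h.symm)
    have h1 : p = ((0, p.2).1 + n * L, (0, p.2).2) := Prod.ext hn rfl
    rw [h1, g.dev_add_int, g.dev_zero_fst] at hp
    refine ⟨-n, ?_⟩
    rw [← hp, ← Equiv.Perm.mul_apply, ← zpow_add]
    simp
  · rintro ⟨n, hn⟩
    have h1 : (g.deck t ^ n) q' = (0, ((g.deck t ^ n) q').2) := Prod.ext hn rfl
    rw [← g.proj_devEquiv_symm_deck t n, h1, g.proj_devEquiv_symm_zero]

/-- Replace the starting point by a deck translate of negative height; the vertical line from it
crosses height 0 after a positive time. -/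
theorem exists_orbit_future (t : ℝ) (q : ℝ × E m) : ∃ s > 0, (g.orbit t q s).1 = 0 := by
  obtain ⟨n, hn⟩ := g.exists_deck_zpow_neg t q
  refine ⟨-((g.deck t ^ n) q).1, by simpa using hn, ?_⟩
  rw [g.orbit_fst_eq_zero_iff]
  exact ⟨n, by rw [g.deck_zpow_add]; simp⟩

theorem exists_orbit_past (t : ℝ) (q : ℝ × E m) : ∃ s < 0, (g.orbit t q s).1 = 0 := by
  obtain ⟨n, hn⟩ := g.exists_deck_zpow_pos t q
  refine ⟨-((g.deck t ^ n) q).1, by simpa using hn, ?_⟩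
  rw [g.orbit_fst_eq_zero_iff]
  exact ⟨n, by rw [g.deck_zpow_add]; simp⟩

/-- The reason is the identity `(σ z + L, z) = deck (0, Φ z)`. -/
theorem orbit_return (t : ℝ) (z : E m) : g.orbit t (0, z) (g.σ t z + L) = (0, g.Φ t z) := by
  have h : (g.deck t ^ (-1 : ℤ)) ((0, z) + (g.σ t z + L, 0)) = (0, g.Φ t z) := by
    rw [zpow_neg_one, deck_inv_apply]
    simp
  rw [orbit, ← g.proj_devEquiv_symm_deck t (-1), h, g.proj_devEquiv_symm_zero]

theorem isLeast_return (t : ℝ) (z : E m) :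
    IsLeast {s : ℝ | 0 < s ∧ (g.orbit t (0, z) s).1 = 0} (g.σ t z + L) := by
  refine ⟨⟨by linarith [g.δ_le t z, g.δ_pos], by rw [g.orbit_return]⟩, ?_⟩
  rintro s ⟨hs, h⟩
  obtain ⟨n, hn⟩ := (g.orbit_fst_eq_zero_iff t _ s).1 h
  have hm := g.strictMono_deck_zpow t ((0, z) + (s, 0))
  -- The point has height `s > 0` at exponent 0 and height 0 at exponent `n`, so `n ≤ -1` by
  -- monotonicity. The height at exponent `-1`, which is `s - L - σ z`, is then nonnegative.
  have h0 : n < 0 := by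
    rw [← hm.lt_iff_lt]
    simp only [hn]
    simpa using hs
  have h1 : ((g.deck t ^ n) ((0, z) + (s, 0))).1 ≤ ((g.deck t ^ (-1 : ℤ)) ((0, z) + (s, 0))).1 :=
    hm.monotone (by omega)
  rw [hn, zpow_neg_one, deck_inv_apply] at h1
  simp only [Prod.mk_add_mk, zero_add, add_zero] at h1
  linarith

end MappingTorus

end ContactTorus

end

noncomputable section

namespace ContactTorus

/-! ### The contact volume -/

theorem volume_real_B {m : ℕ} (hm : 1 ≤ m) :
    (volume (B m)).toReal = Real.pi ^ m / m.factorial := by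
  have : Nonempty (Fin m × Fin 2) := ⟨(⟨0, hm⟩, 0)⟩
  rw [B, InnerProductSpace.volume_ball_of_dim_even (k := m) (by simp [mul_comm])]
  simp only [ENNReal.ofReal_one, one_pow, one_mul]
  exact ENNReal.toReal_ofReal (by positivity)

namespace MappingTorus

variable {m : ℕ} {L : ℝ} (g : MappingTorus m L)

theorem image_dev (t : ℝ) : g.dev t '' (Ioc 0 L ×ˢ B m) =
    {q | q.2 ∈ B m ∧ q.1 ∈ Ioc 0 (L + g.σ t q.2)} := by
  have hε := g.ε_pos
  ext q
  constructor
  · rintro ⟨p, ⟨⟨h0, h1⟩, hp⟩, rfl⟩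
    have h := g.dev_eq_dev₀ t (p := p) (by linarith) (by linarith)
    refine ⟨(g.dev_mem_iff t p).2 hp, ?_, ?_⟩
    · rw [h]
      exact (g.dev₀_pos_iff t p).2 h0
    · rw [h]
      exact (g.dev₀_le_iff t p).2 h1
  · rintro ⟨hq, h0, h1⟩
    obtain ⟨p, hp, rfl⟩ := g.exists_dev₀_eq t h0.le h1
    have h := g.dev_eq_dev₀ t (p := p) (by linarith [hp.1]) (by linarith [hp.2])
    refine ⟨p, ⟨⟨(g.dev₀_pos_iff t p).1 h0, hp.2⟩, ?_⟩, h⟩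
    rw [← h] at hq
    exact (g.dev_mem_iff t p).1 hq

theorem continuous_σ (t : ℝ) : Continuous (g.σ t) :=
  g.contDiff_σ.continuous.comp (Continuous.prodMk_right t)

theorem integrableOn_of_continuous {f : E m → ℝ} (hf : Continuous f) : IntegrableOn f (B m) :=
  (hf.continuousOn.integrableOn_compact (isCompact_closedBall 0 1)).mono_set ball_subset_closedBall

/-- By `image_dev` the region lies under the graph of the return time, so Fubini reduces its volume
to the integral of `L + σ`. -/
theorem volume_image_dev (t : ℝ) : (volume (g.dev t '' (Ioc 0 L ×ˢ B m))).toReal =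
    L * (volume (B m)).toReal + ∫ z in B m, g.σ t z := by
  have hBm : MeasurableSet (B m) := measurableSet_ball
  have hc := g.continuous_σ t
  have hpos : ∀ z, 0 ≤ L + g.σ t z := fun z => by linarith [g.δ_le t z, g.δ_pos]
  have hmeas : MeasurableSet {q : ℝ × E m | q.2 ∈ B m ∧ q.1 ∈ Ioc 0 (L + g.σ t q.2)} :=
    (measurable_snd hBm).inter ((measurableSet_lt measurable_const measurable_fst).inter
      (measurableSet_le measurable_fst
        ((continuous_const.add (hc.comp continuous_snd)).measurable)))
  have hint : IntegrableOn (fun z => L + g.σ t z) (B m) :=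
    integrableOn_of_continuous (continuous_const.add hc)
  have hvol : volume {q : ℝ × E m | q.2 ∈ B m ∧ q.1 ∈ Ioc 0 (L + g.σ t q.2)} =
      ENNReal.ofReal (∫ z in B m, (L + g.σ t z)) := by
    rw [ofReal_integral_eq_lintegral_ofReal hint (Filter.Eventually.of_forall hpos),
      Measure.volume_eq_prod, Measure.prod_apply_symm hmeas, ← lintegral_indicator hBm]
    refine lintegral_congr fun z => ?_
    by_cases hz : z ∈ B m
    · rw [indicator_of_mem hz]
      have : (fun s : ℝ => (s, z)) ⁻¹' {q : ℝ × E m | q.2 ∈ B m ∧ q.1 ∈ Ioc 0 (L + g.σ t q.2)} =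
          Ioc 0 (L + g.σ t z) := by
        ext s
        simp [hz]
      rw [this, Real.volume_Ioc, sub_zero]
    · rw [indicator_of_notMem hz]
      have : (fun s : ℝ => (s, z)) ⁻¹' {q : ℝ × E m | q.2 ∈ B m ∧ q.1 ∈ Ioc 0 (L + g.σ t q.2)} =
          ∅ := by
        ext s
        simp [hz]
      rw [this, measure_empty]
  rw [g.image_dev, hvol, ENNReal.toReal_ofReal (integral_nonneg hpos), integral_add
    (integrableOn_of_continuous continuous_const) (integrableOn_of_continuous hc),
    setIntegral_const, smul_eq_mul, mul_comm]
  rfl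

theorem integrableOn_volCoeff (t : ℝ) :
    IntegrableOn (volCoeff (g.form t)) (Ioc 0 L ×ˢ B m) := by
  have h : volCoeff (g.form t) = fun p => (fderiv ℝ (g.dev t) p).det * m.factorial :=
    funext (g.volCoeff_form t)
  rw [h]
  have hc : Continuous fun p => (fderiv ℝ (g.dev t) p).det * (m.factorial : ℝ) :=
    (g.continuous_det_fderiv_dev t).mul continuous_const
  exact (hc.continuousOn.integrableOn_compact
    (isCompact_Icc.prod (isCompact_closedBall (0 : E m) 1))).mono_set
      (prod_mono Ioc_subset_Icc_self ball_subset_closedBall)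

/-- The density is `m!` times the positive Jacobian of `dev`, so the integral is `m!` times the
volume of the image. The factor `m!` cancels against the ball volume `π^m / m!`. -/
theorem contactVolume_form (hm : 1 ≤ m) (t : ℝ) :
    contactVolume (g.form t) = L * Real.pi ^ m + ∫ z in B m, g.σ t z * m.factorial := by
  have hS : MeasurableSet (Ioc 0 L ×ˢ B m) := measurableSet_Ioc.prod measurableSet_ball
  have : (volume : Measure (ℝ × E m)).IsAddHaarMeasure :=
    inferInstanceAs ((volume : Measure ℝ).prod (volume : Measure (E m))).IsAddHaarMeasure
  have h := integral_image_eq_integral_abs_det_fderiv_smul volume hS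
    (fun p _ => (g.differentiable_dev t p).hasFDerivAt.hasFDerivWithinAt)
    (g.dev_injective t).injOn (fun _ => (1 : ℝ))
  simp only [abs_of_pos (g.det_fderiv_dev_pos t _), smul_eq_mul, mul_one, setIntegral_const] at h
  rw [contactVolume]
  simp only [g.volCoeff_form]
  have hf : (m.factorial : ℝ) ≠ 0 := by exact_mod_cast m.factorial_ne_zero
  rw [integral_mul_const, integral_mul_const, ← h, measureReal_def, g.volume_image_dev,
    volume_real_B hm]
  field_simp

end MappingTorus

/-! ### Assembly of the main theorem -/

theorem exists_mappingTorus {m : ℕ} (hm : 1 ≤ m) {L : ℝ} (hL : 0 < L) {φ : ℝ → E m → E m}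
    (hφ : IsCompSymplIsotopy φ)
    (hτ : ∀ t ∈ Icc (0 : ℝ) 1, ∀ z ∈ B m, 0 < action (φ t) z + L) :
    ∃ g : MappingTorus m L, g.Φ = extendIsotopy φ ∧ g.σ = extendAction φ := by
  obtain ⟨g, hΦ, hσ⟩ := exists_globalIsotopy hm hφ
  obtain ⟨δ, hδ, hδL, hδσ⟩ := exists_lower_bound hm hφ hL hτ
  obtain ⟨a, ε, hε, ha, hal, har, ha0, ha1⟩ := exists_step hδ hδL
  exact ⟨{ toGlobalIsotopy := g
           a := a
           ε := ε
           δ := δ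
           ε_pos := hε
           δ_pos := hδ
           δ_le := fun t z => by rw [hσ]; exact hδσ t z
           contDiff_a := ha
           a_left := hal
           a_right := har
           deriv_a_nonneg := ha0
           deriv_a_lt := ha1 }, hΦ, hσ⟩

end ContactTorus

end

theorem mainTheorem6 (m : ℕ) (hm : 2 ≤ m) (L : ℝ) (hL : 0 < L)
    (φ : ℝ → E m → E m) (hφ : IsCompSymplIsotopy φ)
    (hτ : ∀ t ∈ Icc (0 : ℝ) 1, ∀ z ∈ B m, 0 < action (φ t) z + L) :
    ∃ β : OneForm L m, IsContactForm β ∧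
      -- the contact volume
      (IntegrableOn (volCoeff β) (Ioc 0 L ×ˢ B m) ∧
        contactVolume β = L * Real.pi ^ m + calabi (φ 1)) ∧
      -- the form and its Reeb vector field near the boundary
      (∃ r < (1 : ℝ),
        (∀ x : AddCircle L × E m, x.2 ∈ B m → r < ‖x.2‖ → β x = stdForm L m x) ∧
        (∀ p : ℝ × E m, p.2 ∈ B m → r < ‖p.2‖ → ∀ w, IsReebVector β p w ↔ w = (1, 0))) ∧
      -- the Reeb flow is globally defined
      (∀ x : AddCircle L × E m, x.2 ∈ B m → ∃! γ, IsReebOrbit β γ ∧ γ 0 = x) ∧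
      -- the hypersurface `{0} × B` is transverse to the Reeb flow
      (∀ z ∈ B m, ∀ w, IsReebVector β ((0 : ℝ), z) w → w.1 ≠ 0) ∧
      -- every Reeb orbit meets `{0} × B` in the future and in the past
      (∀ γ, IsReebOrbit β γ → (∃ t > 0, (γ t).1 = 0) ∧ (∃ t < 0, (γ t).1 = 0)) ∧
      -- the first return time and the first return map
      (∀ z ∈ B m, ∀ γ, IsReebOrbit β γ → γ 0 = (0, z) →
        IsLeast {t : ℝ | 0 < t ∧ (γ t).1 = 0} (action (φ 1) z + L) ∧
        γ (action (φ 1) z + L) = (0, φ 1 z)) ∧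
      -- `β` is smoothly isotopic to `ds + λ` through contact forms, relative to the boundary
      (∃ b : ℝ → OneForm L m,
        ContDiffOn ℝ ∞ (fun q : ℝ × (ℝ × E m) => (b q.1).lift q.2)
          (Icc 0 1 ×ˢ (univ ×ˢ B m)) ∧
        (∀ t ∈ Icc (0 : ℝ) 1, IsContactForm (b t)) ∧
        (∀ x : AddCircle L × E m, x.2 ∈ B m → b 0 x = stdForm L m x) ∧
        (∀ x : AddCircle L × E m, x.2 ∈ B m → b 1 x = β x) ∧
        (∃ r < (1 : ℝ), ∀ t ∈ Icc (0 : ℝ) 1, ∀ x : AddCircle L × E m,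
          x.2 ∈ B m → r < ‖x.2‖ → b t x = stdForm L m x)) := by
  obtain ⟨g, hΦ, hσ⟩ := exists_mappingTorus (by omega) hL hφ hτ
  -- The time reparametrisation fixes 1, so at `t = 1` the extended data are the given ones.
  have hΦ1 : ∀ z ∈ B m, g.Φ 1 z = φ 1 z := fun z hz => by
    rw [hΦ, extendIsotopy_of_mem 1 hz, Real.smoothTransition.one]
  have hσ1 : ∀ z ∈ B m, g.σ 1 z = action (φ 1) z := fun z hz => by
    rw [hσ, extendAction_of_mem 1 hz, Real.smoothTransition.one]
  refine ⟨g.form 1, g.isContactForm_form 1, ⟨g.integrableOn_volCoeff 1, ?_⟩,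
    ⟨g.r, g.r_lt_one, fun x _ hx => g.form_far 1 hx, fun p _ hp w => ?_⟩,
    fun x hx => g.existsUnique_isReebOrbit 1 hx, fun z _ w hw => ?_, fun γ hγ => ?_,
    fun z hz γ hγ h0 => ?_,
    ⟨g.form, ?_, fun t _ => g.isContactForm_form t, fun x _ => g.form_zero x, fun x _ => rfl,
      g.r, g.r_lt_one, fun t _ x _ hx => g.form_far t hx⟩⟩
  · rw [g.contactVolume_form (by omega), calabi, wedgePow_stdSymplectic_frameE]
    congr 1
    exact setIntegral_congr_fun measurableSet_ball fun z hz => by simp only [hσ1 z hz]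
  · rw [g.isReebVector_iff, g.fderiv_dev_far 1 hp]
    rfl
  · rw [g.isReebVector_iff, g.fderiv_dev_of_abs_lt 1 (by simpa using g.ε_pos)] at hw
    have hw' : w = (1, 0) := hw
    simp [hw']
  · obtain ⟨q, -, rfl⟩ := g.exists_eq_orbit hγ
    exact ⟨g.exists_orbit_future 1 q, g.exists_orbit_past 1 q⟩
  · obtain ⟨q, -, rfl⟩ := g.exists_eq_orbit hγ
    -- The developed starting point is determined only up to deck transformations; it may be taken
    -- to be `(0, z)`, which `dev` fixes.
    have h1 : g.orbit 1 q = g.orbit 1 (0, z) := by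
      rw [g.orbit_eq_of_zero (p := (0, z)) (by rw [h0]; simp [proj]), g.dev_zero_fst]
    rw [h1, ← hσ1 z hz, ← hΦ1 z hz]
    exact ⟨g.isLeast_return 1 z, g.orbit_return 1 z⟩
  · simp only [g.lift_form]
    exact g.contDiff_coverForm.contDiffOn
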